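/- Let $\mathbb{F}=\mathbb{R}$ or $\mathbb{C}$ and let $n\ge 3$. Let $Q_{2n}$ be the $2n$-dimensional nilpotent Lie algebra over $\mathbb{F}$ with basis $X_1,\dots,X_{2n}$ and brackets $$[X_1,X_k]=X_{k+1}\quad(2\le k\le 2n-2),\qquad [X_k,X_{2n+1-k}]=(-1)^kX_{2n}\quad(2\le k\le n),$$ all other brackets $[X_i,X_j]$ with $i<j$ being zero. Each of the following is a Lie algebra of dimension $2n+1$ with basis $X_1,\dots,X_{2n},Y$, in which $X_1,\dots,X_{2n}$ have the brackets of $Q_{2n}$ and the remaining brackets are as listed: 1. $\mathfrak{r}_{2n+1}(\lambda_2)$, for $\lambda_2\in\mathbb{F}$: $[Y,X_1]=X_1$, $[Y,X_k]=(k-2+\lambda_2)X_k$ for $2\le k\le 2n-1$, $[Y,X_{2n}]=(2n-3+2\lambda_2)X_{2n}$. 2. $\mathfrak{r}_{2n+1}(2-n,\varepsilon)$, for $\varepsilon\in\{-1,0,1\}$: $[Y,X_1]=X_1+\varepsilon X_{2n}$, $[Y,X_k]=(k-n)X_k$ for $2\le k\le 2n-1$, $[Y,X_{2n}]=X_{2n}$.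 3. $\mathfrak{r}_{2n+1}(\lambda_2^{5},\lambda_2^{7},\dots,\lambda_2^{2n-1})$, for parameters $\lambda_2^{2k+1}\in\mathbb{F}$, $2\le k\le n-1$ (the superscript is an index): $[Y,X_1]=0$, $[Y,X_{2+t}]=X_{2+t}+\sum_{k\ge 2,\ 2k+1+t\le 2n-1}\lambda_2^{2k+1}X_{2k+1+t}$ for $0\le t\le 2n-3$, $[Y,X_{2n}]=2X_{2n}$. Every solvable Lie algebra over $\mathbb{F}$ of dimension $2n+1$ whose nilradical (greatest nilpotent ideal) is isomorphic to $Q_{2n}$ is isomorphic to one of the algebras in 1, 2 or 3. Moreover, in 3 the first nonvanishing parameter can be normalized to $1$: if $\lambda_2^{2k+1}\ne 0$ and $\lambda_2^{2j+1}=0$ for all $2\le j<k$, then $\mathfrak{r}_{2n+1}(\lambda_2^5,\dots,\lambda_2^{2n-1})$ is isomorphic to an algebra $\mathfrak{r}_{2n+1}(\mu_2^5,\dots,\mu_2^{2n-1})$ with $\mu_2^{2k+1}=1$ and $\mu_2^{2j+1}=0$ for all $2\le j<k$. -/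

import Mathlib

/-! ### The nilpotent Lie algebra `Q_{2n}` -/

/-- The underlying vector space of `Q_{2n}`: the coordinate space `𝔽^{2n}`, with coordinates
numbered `1, …, 2n`. -/
def QAlg (𝔽 : Type*) (n : ℕ) : Type _ := Set.Icc 1 (2 * n) → 𝔽

namespace QAlg

section Defs

variable {𝔽 : Type*} [Field 𝔽] {n : ℕ}

instance : AddCommGroup (QAlg 𝔽 n) := inferInstanceAs (AddCommGroup (Set.Icc 1 (2 * n) → 𝔽))

instance : Module 𝔽 (QAlg 𝔽 n) := inferInstanceAs (Module 𝔽 (Set.Icc 1 (2 * n) → 𝔽))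

/-- The `k`-th coordinate of `x`, extended by `0` outside `1 ≤ k ≤ 2n`. -/
def coord (x : QAlg 𝔽 n) (k : ℕ) : 𝔽 := if h : k ∈ Set.Icc 1 (2 * n) then x ⟨k, h⟩ else 0

/-- The vector with coordinates `f 1, …, f (2n)`. -/
def ofCoord (f : ℕ → 𝔽) : QAlg 𝔽 n := fun k => f k

/-- The basis vector `X_k` (for `1 ≤ k ≤ 2n`). -/
def X (𝔽 : Type*) [Field 𝔽] (n k : ℕ) : QAlg 𝔽 n := ofCoord fun m => if m = k then 1 else 0

theorem coord_ofCoord (f : ℕ → 𝔽) (k : ℕ) :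
    coord (ofCoord f : QAlg 𝔽 n) k = if 1 ≤ k ∧ k ≤ 2 * n then f k else 0 := by
  unfold coord ofCoord
  by_cases h : 1 ≤ k ∧ k ≤ 2 * n
  · simp [h]
  · simp [h]

theorem coord_ofCoord_of_le (f : ℕ → 𝔽) {k : ℕ} (h : 1 ≤ k) (h' : k ≤ 2 * n) :
    coord (ofCoord f : QAlg 𝔽 n) k = f k := by
  rw [coord_ofCoord, if_pos ⟨h, h'⟩]

@[ext]
theorem ext {x y : QAlg 𝔽 n} (h : ∀ k, 1 ≤ k → k ≤ 2 * n → coord x k = coord y k) : x = y := by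
  funext ⟨k, hk⟩
  have := h k hk.1 hk.2
  simpa [coord, hk.1, hk.2] using this

@[simp] theorem coord_add (x y : QAlg 𝔽 n) (k : ℕ) : coord (x + y) k = coord x k + coord y k := by
  unfold coord
  split_ifs
  · rfl
  · simp

@[simp] theorem coord_sub (x y : QAlg 𝔽 n) (k : ℕ) : coord (x - y) k = coord x k - coord y k := by
  unfold coord
  split_ifs
  · rfl
  · simp

@[simp] theorem coord_zero (k : ℕ) : coord (0 : QAlg 𝔽 n) k = 0 := by
  unfold coord
  split_ifs <;> rfl

@[simp] theorem coord_smul (c : 𝔽) (x : QAlg 𝔽 n) (k : ℕ) : coord (c • x) k = c * coord x k := by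
  unfold coord
  split_ifs
  · rfl
  · simp

/-- The bracket of `Q_{2n}`, the bilinear alternating map with
`[X₁, X_k] = X_{k+1}` for `2 ≤ k ≤ 2n - 2`, `[X_k, X_{2n+1-k}] = (-1)^k X_{2n}` for `2 ≤ k ≤ n`,
all other brackets `[X_i, X_j]`, `i < j`, being zero. -/
instance : Bracket (QAlg 𝔽 n) (QAlg 𝔽 n) where
  bracket x y := ofCoord fun m =>
    if m = 2 * n then
      ∑ k ∈ Finset.Icc 2 n, (-1) ^ k *
        (coord x k * coord y (2 * n + 1 - k) - coord x (2 * n + 1 - k) * coord y k)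
    else if 3 ≤ m then coord x 1 * coord y (m - 1) - coord x (m - 1) * coord y 1
    else 0

/-- The `X_{2n}`-component of the bracket. -/
def top (x y : QAlg 𝔽 n) : 𝔽 :=
  ∑ k ∈ Finset.Icc 2 (2 * n - 1), (-1) ^ k * (coord x k * coord y (2 * n + 1 - k))

theorem top_skew (x y : QAlg 𝔽 n) : top x y = - top y x := by
  unfold top
  rw [← Finset.sum_neg_distrib]
  refine Finset.sum_nbij' (fun k => 2 * n + 1 - k) (fun k => 2 * n + 1 - k) ?_ ?_ ?_ ?_ ?_
  · intro k hk
    simp only [Finset.mem_Icc] at hk ⊢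
    omega
  · intro k hk
    simp only [Finset.mem_Icc] at hk ⊢
    omega
  · intro k hk
    simp only [Finset.mem_Icc] at hk
    omega
  · intro k hk
    simp only [Finset.mem_Icc] at hk
    omega
  · intro k hk
    simp only [Finset.mem_Icc] at hk
    have h1 : 2 * n + 1 - (2 * n + 1 - k) = k := by omega
    have h2 : (-1 : 𝔽) ^ (2 * n + 1 - k) = - (-1) ^ k := by
      rcases Nat.even_or_odd k with h | h
      · have : Odd (2 * n + 1 - k) := by
          rcases h with ⟨r, hr⟩
          exact ⟨n - r, by omega⟩
        rw [h.neg_one_pow, this.neg_one_pow]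
      · have : Even (2 * n + 1 - k) := by
          rcases h with ⟨r, hr⟩
          exact ⟨n - r, by omega⟩
        rw [h.neg_one_pow, this.neg_one_pow, neg_neg]
    rw [h1, h2]
    ring

theorem sum_eq_top (x y : QAlg 𝔽 n) :
    ∑ k ∈ Finset.Icc 2 n, (-1) ^ k *
        (coord x k * coord y (2 * n + 1 - k) - coord x (2 * n + 1 - k) * coord y k) = top x y := by
  have hsplit : Finset.Icc 2 (2 * n - 1) = Finset.Icc 2 n ∪ Finset.Icc (n + 1) (2 * n - 1) := by
    ext k
    simp only [Finset.mem_union, Finset.mem_Icc]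
    omega
  have hdisj : Disjoint (Finset.Icc 2 n) (Finset.Icc (n + 1) (2 * n - 1)) := by
    rw [Finset.disjoint_left]
    intro k
    simp only [Finset.mem_Icc]
    omega
  unfold top
  rw [hsplit, Finset.sum_union hdisj]
  simp only [mul_sub, Finset.sum_sub_distrib]
  rw [sub_eq_add_neg]
  congr 1
  rw [← Finset.sum_neg_distrib]
  refine Finset.sum_nbij' (fun k => 2 * n + 1 - k) (fun k => 2 * n + 1 - k) ?_ ?_ ?_ ?_ ?_
  · intro k hk
    simp only [Finset.mem_Icc] at hk ⊢
    omega
  · intro k hk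
    simp only [Finset.mem_Icc] at hk ⊢
    omega
  · intro k hk
    simp only [Finset.mem_Icc] at hk
    omega
  · intro k hk
    simp only [Finset.mem_Icc] at hk
    omega
  · intro k hk
    simp only [Finset.mem_Icc] at hk
    have h1 : 2 * n + 1 - (2 * n + 1 - k) = k := by omega
    have h2 : (-1 : 𝔽) ^ (2 * n + 1 - k) = - (-1) ^ k := by
      rcases Nat.even_or_odd k with h | h
      · have : Odd (2 * n + 1 - k) := by
          rcases h with ⟨r, hr⟩
          exact ⟨n - r, by omega⟩
        rw [h.neg_one_pow, this.neg_one_pow]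
      · have : Even (2 * n + 1 - k) := by
          rcases h with ⟨r, hr⟩
          exact ⟨n - r, by omega⟩
        rw [h.neg_one_pow, this.neg_one_pow, neg_neg]
    rw [h1, h2]
    ring

theorem coord_lie (x y : QAlg 𝔽 n) (m : ℕ) : coord ⁅x, y⁆ m =
    if 1 ≤ m ∧ m ≤ 2 * n then
      if m = 2 * n then top x y
      else if 3 ≤ m then coord x 1 * coord y (m - 1) - coord x (m - 1) * coord y 1
      else 0
    else 0 := by
  rw [← sum_eq_top]
  exact coord_ofCoord _ m

/-- An auxiliary symmetric form for the Jacobi identity. -/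
def aux (x y : QAlg 𝔽 n) : 𝔽 :=
  ∑ k ∈ Finset.Icc 2 (2 * n - 2), (-1) ^ k * (coord x k * coord y (2 * n - k))

theorem aux_symm (x y : QAlg 𝔽 n) : aux x y = aux y x := by
  unfold aux
  refine Finset.sum_nbij' (fun k => 2 * n - k) (fun k => 2 * n - k) ?_ ?_ ?_ ?_ ?_
  · intro k hk
    simp only [Finset.mem_Icc] at hk ⊢
    omega
  · intro k hk
    simp only [Finset.mem_Icc] at hk ⊢
    omega
  · intro k hk
    simp only [Finset.mem_Icc] at hk
    omega
  · intro k hk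
    simp only [Finset.mem_Icc] at hk
    omega
  · intro k hk
    simp only [Finset.mem_Icc] at hk
    have h1 : 2 * n - (2 * n - k) = k := by omega
    have h2 : (-1 : 𝔽) ^ (2 * n - k) = (-1) ^ k := by
      rcases Nat.even_or_odd k with h | h
      · have : Even (2 * n - k) := by
          rcases h with ⟨r, hr⟩
          exact ⟨n - r, by omega⟩
        rw [h.neg_one_pow, this.neg_one_pow]
      · have : Odd (2 * n - k) := by
          rcases h with ⟨r, hr⟩
          exact ⟨n - r - 1, by omega⟩
        rw [h.neg_one_pow, this.neg_one_pow]
    rw [h1, h2]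
    ring

theorem top_lie (x y z : QAlg 𝔽 n) :
    top x ⁅y, z⁆ = coord y 1 * aux x z - coord z 1 * aux x y := by
  unfold top aux
  have hsub : Finset.Icc 2 (2 * n - 2) ⊆ Finset.Icc 2 (2 * n - 1) := by
    intro k
    simp only [Finset.mem_Icc]
    omega
  rw [← Finset.sum_subset hsub, Finset.mul_sum, Finset.mul_sum, ← Finset.sum_sub_distrib]
  · refine Finset.sum_congr rfl fun k hk => ?_
    simp only [Finset.mem_Icc] at hk
    rw [coord_lie, if_pos (by omega), if_neg (by omega), if_pos (by omega),
      show 2 * n + 1 - k - 1 = 2 * n - k by omega]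
    ring
  · intro k hk hk'
    simp only [Finset.mem_Icc] at hk hk'
    rw [coord_lie, if_pos (by omega), if_neg (by omega), if_neg (by omega)]
    simp

theorem top_add_left (x y z : QAlg 𝔽 n) : top (x + y) z = top x z + top y z := by
  unfold top
  rw [← Finset.sum_add_distrib]
  exact Finset.sum_congr rfl fun k _ => by rw [coord_add]; ring

theorem top_add_right (x y z : QAlg 𝔽 n) : top x (y + z) = top x y + top x z := by
  unfold top
  rw [← Finset.sum_add_distrib]
  exact Finset.sum_congr rfl fun k _ => by rw [coord_add]; ring

theorem top_smul_right (c : 𝔽) (x y : QAlg 𝔽 n) : top x (c • y) = c * top x y := by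
  unfold top
  rw [Finset.mul_sum]
  exact Finset.sum_congr rfl fun k _ => by rw [coord_smul]; ring

theorem top_self (x : QAlg 𝔽 n) : top x x = 0 := by
  rw [← sum_eq_top]
  exact Finset.sum_eq_zero fun k _ => by ring

theorem coord_lie_one (x y : QAlg 𝔽 n) : coord ⁅x, y⁆ 1 = 0 := by
  rw [coord_lie]
  split_ifs
  · omega
  · omega
  · rfl
  · rfl

instance : LieRing (QAlg 𝔽 n) where
  add_lie x y z := by
    ext m h1 h2
    simp only [coord_lie, coord_add, top_add_left]
    split_ifs <;> ring
  lie_add x y z := by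
    ext m h1 h2
    simp only [coord_lie, coord_add, top_add_right]
    split_ifs <;> ring
  lie_self x := by
    ext m h1 h2
    simp only [coord_lie, top_self, coord_zero]
    split_ifs <;> ring
  leibniz_lie x y z := by
    ext m h1 h2
    rw [coord_add, coord_lie x ⁅y, z⁆, coord_lie ⁅x, y⁆ z, coord_lie y ⁅x, z⁆, top_skew ⁅x, y⁆ z]
    simp only [top_lie, coord_lie_one]
    rw [aux_symm z y, aux_symm z x, aux_symm y x]
    split_ifs with ha hb hc
    · ring
    · rw [coord_lie, coord_lie, coord_lie]
      split_ifs
      · omega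
      · ring
      · ring
      · ring
    · ring
    · ring

instance : LieAlgebra 𝔽 (QAlg 𝔽 n) where
  lie_smul c x y := by
    ext m h1 h2
    simp only [coord_lie, coord_smul, top_smul_right]
    split_ifs <;> ring

theorem coord_lie_low (x y : QAlg 𝔽 n) {m : ℕ} (h : m < 3) (h' : m ≠ 2 * n) :
    coord ⁅x, y⁆ m = 0 := by
  rw [coord_lie, if_neg h', if_neg (not_le.2 h), ite_self]

theorem coord_lie_mid (x y : QAlg 𝔽 n) {m : ℕ} (h : 3 ≤ m) (h' : m ≤ 2 * n - 1) :
    coord ⁅x, y⁆ m = coord x 1 * coord y (m - 1) - coord x (m - 1) * coord y 1 := by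
  rw [coord_lie, if_pos (by omega), if_neg (by omega), if_pos h]

theorem coord_lie_top (x y : QAlg 𝔽 n) (h : 1 ≤ n) : coord ⁅x, y⁆ (2 * n) = top x y := by
  rw [coord_lie, if_pos (by omega), if_pos rfl]

/-- The Leibniz rule, checked coordinate by coordinate. -/
theorem leibniz_of {x y u v w : QAlg 𝔽 n}
    (hlow : ∀ m, 1 ≤ m → m < 3 → m ≤ 2 * n - 1 → coord w m = 0)
    (hmid : ∀ m, 3 ≤ m → m ≤ 2 * n - 1 → coord w m =
      (coord x 1 * coord v (m - 1) - coord x (m - 1) * coord v 1) -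
      (coord y 1 * coord u (m - 1) - coord y (m - 1) * coord u 1))
    (htop : 1 ≤ n → coord w (2 * n) = top x v + top u y) :
    w = ⁅x, v⁆ - ⁅y, u⁆ := by
  ext m h1 h2
  rw [coord_sub]
  by_cases hm : m = 2 * n
  · subst hm
    rw [coord_lie_top _ _ (by omega), coord_lie_top _ _ (by omega), htop (by omega), top_skew u y]
    ring
  · rcases Nat.lt_or_ge m 3 with h3 | h3
    · rw [coord_lie_low _ _ h3 hm, coord_lie_low _ _ h3 hm, hlow m h1 h3 (by omega), sub_zero]
    · rw [coord_lie_mid _ _ h3 (by omega), coord_lie_mid _ _ h3 (by omega), hmid m h3 (by omega)]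

theorem mul_top_eq {x y u v : QAlg 𝔽 n} {c : 𝔽}
    (h : ∀ k, 2 ≤ k → k ≤ 2 * n - 1 →
      coord x k * coord v (2 * n + 1 - k) + coord u k * coord y (2 * n + 1 - k) =
        c * (coord x k * coord y (2 * n + 1 - k))) :
    c * top x y = top x v + top u y := by
  unfold top
  rw [Finset.mul_sum, ← Finset.sum_add_distrib]
  refine Finset.sum_congr rfl fun k hk => ?_
  rw [Finset.mem_Icc] at hk
  rw [← mul_add, h k hk.1 hk.2]
  ring

end Defs

/-! ### Derivations of `Q_{2n}` -/

/-- The derivation `F₁¹`: `X₁ ↦ X₁`, `X_k ↦ (k - 2) X_k` for `2 ≤ k ≤ 2n - 1`,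
`X_{2n} ↦ (2n - 3) X_{2n}`. -/
def F11 (𝔽 : Type*) [Field 𝔽] (n : ℕ) : LieDerivation 𝔽 (QAlg 𝔽 n) (QAlg 𝔽 n) where
  toFun x := ofCoord fun m =>
    if m = 2 * n then (2 * (n : 𝔽) - 3) * coord x m
    else if m = 1 then coord x m
    else ((m : 𝔽) - 2) * coord x m
  map_add' x y := by
    ext m h1 h2
    simp only [coord_ofCoord, coord_add]
    split_ifs <;> ring
  map_smul' c x := by
    ext m h1 h2
    simp only [coord_ofCoord, coord_smul, RingHom.id_apply]
    split_ifs <;> ring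
  leibniz' x y := by
    simp only [LinearMap.coe_mk, AddHom.coe_mk]
    refine leibniz_of (fun m h1 h2 h3 => ?_) (fun m h1 h2 => ?_) (fun h => ?_)
    · rw [coord_ofCoord, if_pos (by omega), if_neg (by omega), coord_lie_low _ _ h2 (by omega)]
      simp
    · rw [coord_ofCoord, coord_ofCoord, coord_ofCoord, coord_ofCoord, coord_ofCoord,
        coord_lie_mid _ _ h1 h2]
      obtain ⟨j, rfl⟩ : ∃ j, m = j + 3 := ⟨m - 3, by omega⟩
      have e : j + 3 - 1 = j + 2 := by omega
      have g1 : j + 3 ≤ 2 * n := by omega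
      have g2 : j + 3 ≠ 2 * n := by omega
      have g3 : j + 2 ≤ 2 * n := by omega
      have g4 : j + 2 ≠ 2 * n := by omega
      have g5 : 1 ≤ 2 * n := by omega
      have g6 : 1 ≠ 2 * n := by omega
      simp [e, g1, g2, g3, g4, g5, g6]
      ring
    · rw [coord_ofCoord, if_pos (by omega), if_pos rfl, coord_lie_top _ _ h]
      refine mul_top_eq fun k hk hk' => ?_
      rw [coord_ofCoord_of_le _ (by omega) (by omega), coord_ofCoord_of_le _ (by omega) (by omega),
        if_neg (by omega), if_neg (by omega), if_neg (by omega), if_neg (by omega), Nat.cast_sub (by omega)]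
      push_cast
      ring

/-- The derivation `F₂²`: `X₁ ↦ 0`, `X_k ↦ X_k` for `2 ≤ k ≤ 2n - 1`, `X_{2n} ↦ 2 X_{2n}`. -/
def F22 (𝔽 : Type*) [Field 𝔽] (n : ℕ) : LieDerivation 𝔽 (QAlg 𝔽 n) (QAlg 𝔽 n) where
  toFun x := ofCoord fun m =>
    if m = 2 * n then 2 * coord x m
    else if m = 1 then 0
    else coord x m
  map_add' x y := by
    ext m h1 h2
    simp only [coord_ofCoord, coord_add]
    split_ifs <;> ring
  map_smul' c x := by
    ext m h1 h2
    simp only [coord_ofCoord, coord_smul, RingHom.id_apply]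
    split_ifs <;> ring
  leibniz' x y := by
    simp only [LinearMap.coe_mk, AddHom.coe_mk]
    refine leibniz_of (fun m h1 h2 h3 => ?_) (fun m h1 h2 => ?_) (fun h => ?_)
    · rw [coord_ofCoord, if_pos (by omega), if_neg (by omega), coord_lie_low _ _ h2 (by omega)]
      simp
    · rw [coord_ofCoord, coord_ofCoord, coord_ofCoord, coord_ofCoord, coord_ofCoord,
        coord_lie_mid _ _ h1 h2]
      obtain ⟨j, rfl⟩ : ∃ j, m = j + 3 := ⟨m - 3, by omega⟩
      have e : j + 3 - 1 = j + 2 := by omega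
      have g1 : j + 3 ≤ 2 * n := by omega
      have g2 : j + 3 ≠ 2 * n := by omega
      have g3 : j + 2 ≤ 2 * n := by omega
      have g4 : j + 2 ≠ 2 * n := by omega
      have g5 : 1 ≤ 2 * n := by omega
      have g6 : 1 ≠ 2 * n := by omega
      simp [e, g1, g2, g3, g4, g5, g6]
      ring
    · rw [coord_ofCoord, if_pos (by omega), if_pos rfl, coord_lie_top _ _ h]
      refine mul_top_eq fun k hk hk' => ?_
      rw [coord_ofCoord_of_le _ (by omega) (by omega), coord_ofCoord_of_le _ (by omega) (by omega),
        if_neg (by omega), if_neg (by omega), if_neg (by omega), if_neg (by omega)]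
      ring

/-- The derivation `F₁^{2n}`: `X₁ ↦ X_{2n}`, and `X_k ↦ 0` for `2 ≤ k ≤ 2n`. -/
def F12n (𝔽 : Type*) [Field 𝔽] (n : ℕ) : LieDerivation 𝔽 (QAlg 𝔽 n) (QAlg 𝔽 n) where
  toFun x := ofCoord fun m => if m = 2 * n then coord x 1 else 0
  map_add' x y := by
    ext m h1 h2
    simp only [coord_ofCoord, coord_add]
    split_ifs <;> ring
  map_smul' c x := by
    ext m h1 h2
    simp only [coord_ofCoord, coord_smul, RingHom.id_apply]
    split_ifs <;> ring
  leibniz' x y := by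
    simp only [LinearMap.coe_mk, AddHom.coe_mk]
    refine leibniz_of (fun m h1 h2 h3 => ?_) (fun m h1 h2 => ?_) (fun h => ?_)
    · rw [coord_ofCoord, if_pos (by omega), if_neg (by omega)]
    · rw [coord_ofCoord, coord_ofCoord, coord_ofCoord, coord_ofCoord, coord_ofCoord,
        if_pos (by omega), if_neg (by omega), if_pos (by omega), if_neg (by omega),
        if_pos (by omega), if_neg (by omega), if_pos (by omega), if_neg (by omega),
        if_pos (by omega), if_neg (by omega)]
      ring
    · rw [coord_ofCoord, if_pos (by omega), if_pos rfl, coord_lie_one]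
      rw [← mul_top_eq (c := 0), zero_mul]
      intro k hk hk'
      rw [coord_ofCoord_of_le _ (by omega) (by omega), coord_ofCoord_of_le _ (by omega) (by omega),
        if_neg (by omega), if_neg (by omega)]
      ring

/-- For `k ≥ 1`, the derivation `F₂^{2k+1}`: `X_{2+t} ↦ X_{2k+1+t}` whenever `t ≥ 0` and
`2k + 1 + t ≤ 2n - 1`, all the other basis vectors being sent to `0`. (It is `0` for `k = 0`.) -/
def F2odd (𝔽 : Type*) [Field 𝔽] (n k : ℕ) : LieDerivation 𝔽 (QAlg 𝔽 n) (QAlg 𝔽 n) where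
  toFun x := ofCoord fun m =>
    if 1 ≤ k ∧ 2 * k + 1 ≤ m ∧ m ≤ 2 * n - 1 then coord x (m + 1 - 2 * k) else 0
  map_add' x y := by
    ext m h1 h2
    simp only [coord_ofCoord, coord_add]
    split_ifs <;> ring
  map_smul' c x := by
    ext m h1 h2
    simp only [coord_ofCoord, coord_smul, RingHom.id_apply]
    split_ifs <;> ring
  leibniz' x y := by
    simp only [LinearMap.coe_mk, AddHom.coe_mk]
    refine leibniz_of (fun m h1 h2 h3 => ?_) (fun m h1 h2 => ?_) (fun h => ?_)
    · rw [coord_ofCoord, if_pos (by omega), if_neg (by omega)]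
    · rw [coord_ofCoord_of_le _ (by omega) (by omega)]
      have hv : ∀ z : QAlg 𝔽 n, ∀ i, 1 ≤ i → i ≤ 2 * n →
          coord (ofCoord fun m => if 1 ≤ k ∧ 2 * k + 1 ≤ m ∧ m ≤ 2 * n - 1
            then coord z (m + 1 - 2 * k) else 0 : QAlg 𝔽 n) i =
          if 1 ≤ k ∧ 2 * k + 1 ≤ i ∧ i ≤ 2 * n - 1 then coord z (i + 1 - 2 * k) else 0 :=
        fun z i hi hi' => coord_ofCoord_of_le _ hi hi'
      rw [hv y 1 (by omega) (by omega), hv x 1 (by omega) (by omega),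
        hv y (m - 1) (by omega) (by omega), hv x (m - 1) (by omega) (by omega)]
      have h0 : ¬ (1 ≤ k ∧ 2 * k + 1 ≤ 1 ∧ 1 ≤ 2 * n - 1) := by omega
      rw [if_neg h0, if_neg h0]
      by_cases hk : 1 ≤ k ∧ 2 * k + 1 ≤ m
      · rw [if_pos (by omega)]
        by_cases hk' : 2 * k + 1 = m
        · rw [if_neg (by omega), if_neg (by omega), coord_lie_low _ _ (by omega) (by omega)]
          ring
        · rw [if_pos (by omega), if_pos (by omega), coord_lie_mid _ _ (by omega) (by omega),
            show m - 1 + 1 - 2 * k = m + 1 - 2 * k - 1 by omega]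
          ring
      · rw [if_neg (by omega), if_neg (by omega), if_neg (by omega)]
        ring
    · rw [coord_ofCoord, if_pos (by omega), if_neg (by omega)]
      by_cases hk : 1 ≤ k
      swap
      · rw [← mul_top_eq (c := 0), zero_mul]
        intro i hi hi'
        rw [coord_ofCoord_of_le _ (by omega) (by omega), coord_ofCoord_of_le _ (by omega) (by omega),
          if_neg (by omega), if_neg (by omega)]
        ring
      rw [← sub_neg_eq_add, eq_comm, sub_eq_zero]
      unfold top
      rw [← Finset.sum_neg_distrib]
      have hL : Finset.Icc 2 (2 * n - 2 * k) ⊆ Finset.Icc 2 (2 * n - 1) := by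
        intro i
        simp only [Finset.mem_Icc]
        omega
      have hR : Finset.Icc (2 * k + 1) (2 * n - 1) ⊆ Finset.Icc 2 (2 * n - 1) := by
        intro i
        simp only [Finset.mem_Icc]
        omega
      rw [← Finset.sum_subset hL, ← Finset.sum_subset hR]
      · refine Finset.sum_nbij' (fun i => i + 2 * k - 1) (fun i => i + 1 - 2 * k) ?_ ?_ ?_ ?_ ?_
        · intro i hi
          simp only [Finset.mem_Icc] at hi ⊢
          omega
        · intro i hi
          simp only [Finset.mem_Icc] at hi ⊢
          omega
        · intro i hi
          simp only [Finset.mem_Icc] at hi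
          omega
        · intro i hi
          simp only [Finset.mem_Icc] at hi
          omega
        · intro i hi
          simp only [Finset.mem_Icc] at hi
          rw [coord_ofCoord_of_le _ (by omega) (by omega), coord_ofCoord_of_le _ (by omega) (by omega),
            if_pos (by omega), if_pos (by omega), show i + 2 * k - 1 + 1 - 2 * k = i by omega,
            show 2 * n + 1 - i + 1 - 2 * k = 2 * n + 1 - (i + 2 * k - 1) by omega,
            show i + 2 * k - 1 = i + 2 * (k - 1) + 1 by omega, pow_succ, pow_add, pow_mul]
          simp
      · intro i hi hi'
        simp only [Finset.mem_Icc] at hi hi'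
        rw [coord_ofCoord, if_pos (by omega), if_neg (by omega)]
        ring
      · intro i hi hi'
        simp only [Finset.mem_Icc] at hi hi'
        rw [coord_ofCoord, if_pos (by omega), if_neg (by omega)]
        ring

/-! ### The tables of brackets and derivations on the basis `X_1, …, X_{2n}` -/

section Tables

variable {𝔽 : Type*} [Field 𝔽] {n : ℕ}

theorem coord_X (k : ℕ) {m : ℕ} (h : 1 ≤ m) (h' : m ≤ 2 * n) :
    coord (X 𝔽 n k) m = if m = k then 1 else 0 :=
  coord_ofCoord_of_le _ h h'

theorem lie_X_one {k : ℕ} (h : 2 ≤ k) (h' : k ≤ 2 * n - 2) :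
    ⁅X 𝔽 n 1, X 𝔽 n k⁆ = X 𝔽 n (k + 1) := by
  ext m h1 h2
  rw [coord_X _ h1 h2]
  by_cases hm : m = 2 * n
  · rw [hm, coord_lie_top _ _ (by omega), if_neg (by omega)]
    refine Finset.sum_eq_zero fun i hi => ?_
    rw [Finset.mem_Icc] at hi
    rw [coord_X 1 (by omega) (by omega), if_neg (by omega)]
    ring
  · rcases Nat.lt_or_ge m 3 with h3 | h3
    · rw [coord_lie_low _ _ h3 hm, if_neg (by omega)]
    · rw [coord_lie_mid _ _ h3 (by omega), coord_X 1 (by omega) (by omega),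
        coord_X k (by omega) (by omega), coord_X 1 (by omega) (by omega), if_pos rfl,
        if_neg (show ¬ m - 1 = 1 by omega), zero_mul, sub_zero, one_mul]
      exact if_congr (by omega) rfl rfl

theorem lie_X_of_two_le {i j : ℕ} (hi : 2 ≤ i) (hi' : i ≤ 2 * n) (hj : 2 ≤ j) (hj' : j ≤ 2 * n) :
    ⁅X 𝔽 n i, X 𝔽 n j⁆ = if i + j = 2 * n + 1 then (-1 : 𝔽) ^ i • X 𝔽 n (2 * n) else 0 := by
  ext m h1 h2
  by_cases hm : m = 2 * n
  · rw [hm, coord_lie_top _ _ (by omega)]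
    unfold top
    have hterm : ∀ k ∈ Finset.Icc 2 (2 * n - 1),
        (-1 : 𝔽) ^ k * (coord (X 𝔽 n i) k * coord (X 𝔽 n j) (2 * n + 1 - k)) =
          if k = i then (if i + j = 2 * n + 1 then (-1 : 𝔽) ^ i else 0) else 0 := by
      intro k hk
      rw [Finset.mem_Icc] at hk
      rw [coord_X i (by omega) (by omega), coord_X j (by omega) (by omega)]
      by_cases hki : k = i
      · subst hki
        by_cases hs : k + j = 2 * n + 1
        · rw [if_pos rfl, if_pos (by omega), if_pos rfl, if_pos hs]
          ring
        · rw [if_pos rfl, if_neg (by omega), if_pos rfl, if_neg hs]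
          ring
      · rw [if_neg hki, if_neg hki]
        ring
    rw [Finset.sum_congr rfl hterm, Finset.sum_ite_eq']
    by_cases hs : i + j = 2 * n + 1
    · rw [if_pos hs, if_pos hs, if_pos (Finset.mem_Icc.2 (by omega)), coord_smul,
        coord_X _ (by omega) (by omega), if_pos rfl, mul_one]
    · rw [if_neg hs, if_neg hs, ite_self, coord_zero]
  · have hr : coord (if i + j = 2 * n + 1 then (-1 : 𝔽) ^ i • X 𝔽 n (2 * n) else 0) m = 0 := by
      split_ifs
      · rw [coord_smul, coord_X _ h1 h2, if_neg hm, mul_zero]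
      · exact coord_zero m
    rw [hr]
    rcases Nat.lt_or_ge m 3 with h3 | h3
    · rw [coord_lie_low _ _ h3 hm]
    · rw [coord_lie_mid _ _ h3 (by omega), coord_X i (by omega) (by omega),
        coord_X j le_rfl (by omega), if_neg (by omega), if_neg (by omega)]
      ring

theorem lie_X_one_of_le {k : ℕ} (h : 2 * n - 1 ≤ k) (h' : k ≤ 2 * n) (hn : 2 ≤ n) :
    ⁅X 𝔽 n 1, X 𝔽 n k⁆ = 0 := by
  ext m h1 h2
  rw [coord_zero]
  by_cases hm : m = 2 * n
  · rw [hm, coord_lie_top _ _ (by omega)]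
    refine Finset.sum_eq_zero fun i hi => ?_
    rw [Finset.mem_Icc] at hi
    rw [coord_X 1 (by omega) (by omega), if_neg (by omega)]
    ring
  · rcases Nat.lt_or_ge m 3 with h3 | h3
    · rw [coord_lie_low _ _ h3 hm]
    · rw [coord_lie_mid _ _ h3 (by omega), coord_X k (by omega) (by omega),
        coord_X k (by omega) (by omega), if_neg (by omega), if_neg (by omega)]
      ring

theorem F11_apply (x : QAlg 𝔽 n) : F11 𝔽 n x = ofCoord fun m =>
    if m = 2 * n then (2 * (n : 𝔽) - 3) * coord x m
    else if m = 1 then coord x m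
    else ((m : 𝔽) - 2) * coord x m :=
  rfl

theorem F22_apply (x : QAlg 𝔽 n) : F22 𝔽 n x = ofCoord fun m =>
    if m = 2 * n then 2 * coord x m else if m = 1 then 0 else coord x m :=
  rfl

theorem F12n_apply (x : QAlg 𝔽 n) : F12n 𝔽 n x = ofCoord fun m => if m = 2 * n then coord x 1 else 0 :=
  rfl

theorem F2odd_apply (k : ℕ) (x : QAlg 𝔽 n) : F2odd 𝔽 n k x = ofCoord fun m =>
    if 1 ≤ k ∧ 2 * k + 1 ≤ m ∧ m ≤ 2 * n - 1 then coord x (m + 1 - 2 * k) else 0 :=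
  rfl

theorem F11_X {k : ℕ} (h : 1 ≤ k) (h' : k ≤ 2 * n) : F11 𝔽 n (X 𝔽 n k) =
    (if k = 2 * n then 2 * (n : 𝔽) - 3 else if k = 1 then 1 else (k : 𝔽) - 2) • X 𝔽 n k := by
  ext m h1 h2
  rw [F11_apply, coord_ofCoord_of_le _ h1 h2]
  rw [coord_smul, coord_X _ h1 h2]
  by_cases hm : m = k
  · subst hm
    split_ifs <;> ring
  · simp [hm]

theorem F22_X {k : ℕ} (h : 1 ≤ k) (h' : k ≤ 2 * n) : F22 𝔽 n (X 𝔽 n k) =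
    (if k = 2 * n then 2 else if k = 1 then 0 else 1 : 𝔽) • X 𝔽 n k := by
  ext m h1 h2
  rw [F22_apply, coord_ofCoord_of_le _ h1 h2]
  rw [coord_smul, coord_X _ h1 h2]
  by_cases hm : m = k
  · subst hm
    split_ifs <;> ring
  · simp [hm]

theorem F12n_X (k : ℕ) :
    F12n 𝔽 n (X 𝔽 n k) = if k = 1 then X 𝔽 n (2 * n) else 0 := by
  ext m h1 h2
  rw [F12n_apply, coord_ofCoord_of_le _ h1 h2]
  rw [coord_X _ le_rfl (by omega)]
  by_cases hk : k = 1
  · rw [if_pos hk.symm, if_pos hk, coord_X _ h1 h2]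
  · rw [if_neg (Ne.symm hk), if_neg hk, coord_zero, ite_self]

theorem F2odd_X {k t : ℕ} (hk : 1 ≤ k) (ht : 2 + t ≤ 2 * n) : F2odd 𝔽 n k (X 𝔽 n (2 + t)) =
    if 2 * k + 1 + t ≤ 2 * n - 1 then X 𝔽 n (2 * k + 1 + t) else 0 := by
  ext m h1 h2
  rw [F2odd_apply, coord_ofCoord_of_le _ h1 h2]
  by_cases hm : 1 ≤ k ∧ 2 * k + 1 ≤ m ∧ m ≤ 2 * n - 1
  · rw [if_pos hm, coord_X _ (by omega) (by omega)]
    by_cases hs : 2 * k + 1 + t ≤ 2 * n - 1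
    · rw [if_pos hs, coord_X _ h1 h2]
      exact if_congr (by omega) rfl rfl
    · rw [if_neg hs, if_neg (by omega), coord_zero]
  · rw [if_neg hm]
    by_cases hs : 2 * k + 1 + t ≤ 2 * n - 1
    · rw [if_pos hs, coord_X _ h1 h2, if_neg (by omega)]
    · rw [if_neg hs, coord_zero]

theorem F2odd_X_one {k : ℕ} : F2odd 𝔽 n k (X 𝔽 n 1) = 0 := by
  ext m h1 h2
  rw [F2odd_apply, coord_ofCoord_of_le _ h1 h2]
  rw [coord_zero]
  split_ifs
  · rw [coord_X _ (by omega) (by omega), if_neg (by omega)]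
  · rfl

end Tables

end QAlg

/-! ### The extensions of `Q_{2n}` by one derivation -/

section Extension

attribute [local instance] LieRing.ofAssociativeRing

/-- The homomorphism `𝔽 → Der K`, `s ↦ s D`, from the one-dimensional (abelian) Lie algebra. -/
def lineHom {𝔽 K : Type*} [Field 𝔽] [LieRing K] [LieAlgebra 𝔽 K] (D : LieDerivation 𝔽 K K) :
    𝔽 →ₗ⁅𝔽⁆ LieDerivation 𝔽 K K where
  toFun s := s • D
  map_add' s t := add_smul s t D
  map_smul' s t := by simp [mul_smul]
  map_lie' {s t} := by
    ext x
    simp [LieRing.of_associative_ring_bracket, mul_comm s t]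

/-- The semidirect sum of `K` with a line `𝔽 Y`, where `[Y, x] = D x` for `x ∈ K`. -/
def DerExt {𝔽 K : Type*} [Field 𝔽] [LieRing K] [LieAlgebra 𝔽 K] (D : LieDerivation 𝔽 K K) :
    Type _ :=
  LieAlgebra.SemiDirectSum K 𝔽 (lineHom D)

noncomputable instance {𝔽 K : Type*} [Field 𝔽] [LieRing K] [LieAlgebra 𝔽 K]
    (D : LieDerivation 𝔽 K K) : LieRing (DerExt D) :=
  inferInstanceAs (LieRing (LieAlgebra.SemiDirectSum K 𝔽 (lineHom D)))

noncomputable instance {𝔽 K : Type*} [Field 𝔽] [LieRing K] [LieAlgebra 𝔽 K]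
    (D : LieDerivation 𝔽 K K) : LieAlgebra 𝔽 (DerExt D) :=
  inferInstanceAs (LieAlgebra 𝔽 (LieAlgebra.SemiDirectSum K 𝔽 (lineHom D)))

/-- The underlying vector space of the extension is `K × 𝔽`; `(x, s)` stands for `x + s Y`. -/
def DerExt.toProd {𝔽 K : Type*} [Field 𝔽] [LieRing K] [LieAlgebra 𝔽 K]
    (D : LieDerivation 𝔽 K K) : DerExt D ≃ₗ[𝔽] K × 𝔽 :=
  LieAlgebra.SemiDirectSum.toProdl (lineHom D)

theorem DerExt.toProd_lie {𝔽 K : Type*} [Field 𝔽] [LieRing K] [LieAlgebra 𝔽 K]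
    (D : LieDerivation 𝔽 K K) (u v : DerExt D) : DerExt.toProd D ⁅u, v⁆ =
      (⁅(DerExt.toProd D u).1, (DerExt.toProd D v).1⁆ +
        (DerExt.toProd D u).2 • D (DerExt.toProd D v).1 -
        (DerExt.toProd D v).2 • D (DerExt.toProd D u).1, 0) := by
  refine Prod.ext rfl ?_
  change (DerExt.toProd D u).2 * (DerExt.toProd D v).2 -
    (DerExt.toProd D v).2 * (DerExt.toProd D u).2 = 0
  ring

end Extension

/-! ### The three types of solvable algebras -/

/-- `𝔯_{2n+1}(λ₂)`: `[Y, X₁] = X₁`, `[Y, X_k] = (k - 2 + λ₂) X_k` for `2 ≤ k ≤ 2n - 1`,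
`[Y, X_{2n}] = (2n - 3 + 2λ₂) X_{2n}`. -/
abbrev SolvDiag {𝔽 : Type*} [Field 𝔽] (n : ℕ) (lam : 𝔽) : Type _ :=
  DerExt (QAlg.F11 𝔽 n + lam • QAlg.F22 𝔽 n)

/-- `𝔯_{2n+1}(2 - n, ε)`: `[Y, X₁] = X₁ + ε X_{2n}`, `[Y, X_k] = (k - n) X_k` for
`2 ≤ k ≤ 2n - 1`, `[Y, X_{2n}] = X_{2n}`. -/
abbrev SolvEps {𝔽 : Type*} [Field 𝔽] (n : ℕ) (ε : 𝔽) : Type _ :=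
  DerExt (QAlg.F11 𝔽 n + (2 - (n : 𝔽)) • QAlg.F22 𝔽 n + ε • QAlg.F12n 𝔽 n)

/-- `𝔯_{2n+1}(λ₂⁵, λ₂⁷, …, λ₂^{2n-1})`, where `l (2k+1)` is the parameter `λ₂^{2k+1}`,
`2 ≤ k ≤ n - 1` (the other values of `l` are irrelevant): `[Y, X₁] = 0`,
`[Y, X_{2+t}] = X_{2+t} + ∑_k λ₂^{2k+1} X_{2k+1+t}` for `0 ≤ t ≤ 2n - 3`, the sum being over all
`k ≥ 2` with `2k + 1 + t ≤ 2n - 1`, and `[Y, X_{2n}] = 2 X_{2n}`. -/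
abbrev SolvFam {𝔽 : Type*} [Field 𝔽] (n : ℕ) (l : ℕ → 𝔽) : Type _ :=
  DerExt (QAlg.F22 𝔽 n + ∑ k ∈ Finset.Icc 2 (n - 1), l (2 * k + 1) • QAlg.F2odd 𝔽 n k)

/-- `N` is the nilradical of `L`: the greatest ideal of `L` that is nilpotent as a Lie algebra.
(Mathlib's `LieAlgebra.maxNilpotentIdeal` is about nilpotency of the ideal as an `L`-module and is
a different, smaller ideal.) -/
def IsNilradical {𝔽 L : Type*} [Field 𝔽] [LieRing L] [LieAlgebra 𝔽 L] (N : LieIdeal 𝔽 L) : Prop :=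
  IsGreatest {I : LieIdeal 𝔽 L | LieRing.IsNilpotent I} N

/-! A one-dimensional extension of `Q_{2n}` is determined by a derivation `D`, namely `ad Y`, and
replacing `D` by `φ (a D + ad z) φ⁻¹`, with `a ≠ 0` and `φ` an automorphism, does not change the
isomorphism type (`DerExt.nonempty_equiv`). So the task is to find the derivations modulo inner ones
and then to normalize them.

A derivation is determined by its values on `X₁` and `X₂`. The Leibniz rule on a few vanishing
brackets forces enough coordinates of these values to vanish that, modulo inner derivations, only `p
F₁¹ + q F₂² + c F₁^{2n} + ∑ b_k F₂^{2k+1}` remains (`exists_eq_standardDerivation_add_inner`). Here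
`F₁¹` and `F₂²` are diagonal, while `F₁^{2n}` and the `F₂^{2k+1}` are commuting nilpotent
eigenvectors for them, the combination `p F₁¹ + q F₂²` having weight `p (2n - 4) + 2q` on the first
and `p (2k - 1)` on the others.

Conjugation by the exponential of a nilpotent eigenvector removes its coefficient whenever the
weight is nonzero (`exists_equiv_standardDerivation`). If `p ≠ 0`, all `b_k` go, and `c` survives
only at the resonance `q/p = 2 - n`; if `p = 0` and `q ≠ 0`, `c` goes and the `b_k` stay. If `p = q
= 0`, the extension is nilpotent by Engel's theorem (`isNilpotent_derExt`), so `Q_{2n}` would not be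
the nilradical. The diagonal automorphisms `scaleHom` rescale what survives: `c` by a square, and
`b_k` by the odd power `α^(2k-1)`, which takes every value over `ℝ` as well as over `ℂ`. -/

namespace QAlg

/-! ### Derivations of `Q_{2n}` modulo inner derivations -/

section Derivations

variable {𝔽 : Type*} [Field 𝔽] {n : ℕ}

theorem eq_sum_X (x : QAlg 𝔽 n) : x = ∑ k ∈ Finset.Icc 1 (2 * n), coord x k • X 𝔽 n k := by
  let f : ℕ → QAlg 𝔽 n →+ 𝔽 := fun m => ⟨⟨fun x => coord x m, coord_zero m⟩, fun x y => coord_add x y m⟩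
  ext m h1 h2
  change f m x = f m _
  rw [map_sum, Finset.sum_eq_single m]
  · change coord x m = coord (coord x m • X 𝔽 n m) m
    rw [coord_smul, coord_X _ h1 h2, if_pos rfl, mul_one]
  · intro k _ hk
    change coord (coord x k • X 𝔽 n k) m = 0
    rw [coord_smul, coord_X _ h1 h2, if_neg hk.symm, mul_zero]
  · intro h
    exact absurd (Finset.mem_Icc.2 ⟨h1, h2⟩) h

theorem coord_sum {ι : Type*} (s : Finset ι) (f : ι → QAlg 𝔽 n) (m : ℕ) :
    coord (∑ i ∈ s, f i) m = ∑ i ∈ s, coord (f i) m :=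
  map_sum (⟨⟨fun x => coord x m, coord_zero m⟩, fun x y => coord_add x y m⟩ : QAlg 𝔽 n →+ 𝔽) f s

theorem top_X_left {i : ℕ} (h : 1 ≤ i) (h' : i ≤ 2 * n) (y : QAlg 𝔽 n) : top (X 𝔽 n i) y =
    if 2 ≤ i ∧ i ≤ 2 * n - 1 then (-1) ^ i * coord y (2 * n + 1 - i) else 0 := by
  unfold top
  have : ∀ k ∈ Finset.Icc 2 (2 * n - 1),
      (-1 : 𝔽) ^ k * (coord (X 𝔽 n i) k * coord y (2 * n + 1 - k)) =
        if k = i then (-1) ^ i * coord y (2 * n + 1 - i) else 0 := by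
    intro k hk
    rw [Finset.mem_Icc] at hk
    rw [coord_X i (by omega) (by omega)]
    split_ifs with hki
    · rw [hki, one_mul]
    · ring
  rw [Finset.sum_congr rfl this, Finset.sum_ite_eq']
  simp [Finset.mem_Icc]

theorem top_X_right {i : ℕ} (h : 1 ≤ i) (h' : i ≤ 2 * n) (y : QAlg 𝔽 n) : top y (X 𝔽 n i) =
    if 2 ≤ i ∧ i ≤ 2 * n - 1 then -((-1) ^ i * coord y (2 * n + 1 - i)) else 0 := by
  rw [top_skew, top_X_left h h']
  split_ifs <;> simp

/-- `Q_{2n}` is generated by `X₁` and `X₂`. -/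
theorem derivation_eq_zero (hn : 3 ≤ n) (D : LieDerivation 𝔽 (QAlg 𝔽 n) (QAlg 𝔽 n))
    (h1 : D (X 𝔽 n 1) = 0) (h2 : D (X 𝔽 n 2) = 0) : D = 0 := by
  have key : ∀ t, 2 + t ≤ 2 * n - 1 → D (X 𝔽 n (2 + t)) = 0 := by
    intro t
    induction t with
    | zero => intro _; exact h2
    | succ t ih =>
      intro ht
      rw [← add_assoc, ← lie_X_one (by omega) (by omega), LieDerivation.apply_lie_eq_add, h1,
        ih (by omega)]
      simp
  have htop : D (X 𝔽 n (2 * n)) = 0 := by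
    have h := lie_X_of_two_le (𝔽 := 𝔽) (n := n) (i := 2) (j := 2 * n - 1) (by omega) (by omega)
      (by omega) (by omega)
    rw [if_pos (by omega)] at h
    have e : X 𝔽 n (2 * n - 1) = X 𝔽 n (2 + (2 * n - 3)) := by congr 1; omega
    have h' := congrArg D h
    rw [LieDerivation.apply_lie_eq_add, h2, e, key _ (by omega)] at h'
    simpa using h'.symm
  ext1 x
  rw [eq_sum_X x, map_sum]
  refine Finset.sum_eq_zero fun k hk => ?_
  rw [Finset.mem_Icc] at hk
  rw [map_smul]
  obtain rfl | hk1 := eq_or_ne k 1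
  · rw [h1, smul_zero]
  obtain rfl | hk2 := eq_or_ne k (2 * n)
  · rw [htop, smul_zero]
  · obtain ⟨t, rfl⟩ : ∃ t, k = 2 + t := ⟨k - 2, by omega⟩
    rw [key t (by omega), smul_zero]

variable (D : LieDerivation 𝔽 (QAlg 𝔽 n) (QAlg 𝔽 n))

/-- Apply `D` to `[X₂, X₃] = 0` and read off the coefficient of `X₄`. The bracket vanishes because
`n ≥ 3`. -/
theorem derivation_X_two_coord_one (hn : 3 ≤ n) : coord (D (X 𝔽 n 2)) 1 = 0 := by
  have h := lie_X_of_two_le (𝔽 := 𝔽) (n := n) (i := 2) (j := 3) (by omega) (by omega)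
    (by omega) (by omega)
  rw [if_neg (by omega)] at h
  have h' := congrArg (fun x => coord (D x) 4) h
  simp only [LieDerivation.apply_lie_eq_add, coord_add, map_zero, coord_zero] at h'
  rw [coord_lie_mid _ _ (by omega) (by omega), coord_lie_mid _ _ (by omega) (by omega),
    coord_X 2 (by omega) (by omega), coord_X 2 (by omega) (by omega), coord_X 3 (by omega) (by omega),
    coord_X 3 (by omega) (by omega)] at h'
  simpa using h'

/-- Apply `D` to `[X₁, X_{2n-1}] = 0` and read off the coefficient of `X_{2n}`. -/
theorem derivation_X_one_coord_two (hn : 3 ≤ n) : coord (D (X 𝔽 n 1)) 2 = 0 := by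
  have h := lie_X_one_of_le (𝔽 := 𝔽) (n := n) (k := 2 * n - 1) (by omega) (by omega) (by omega)
  have h' := congrArg (fun x => coord (D x) (2 * n)) h
  simp only [LieDerivation.apply_lie_eq_add, coord_add, map_zero, coord_zero] at h'
  rw [coord_lie_top _ _ (by omega), coord_lie_top _ _ (by omega), top_X_left (by omega) (by omega),
    top_X_right (by omega) (by omega), if_neg (by omega), if_pos (by omega),
    show 2 * n + 1 - (2 * n - 1) = 2 by omega] at h'
  simpa using h'

/-- Since `X_{k+1} = [X₁, X_k]`, the matrix of `D` is carried along its diagonals by `ad X₁`. The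
correction `[D X₁, X_k]` meets only the coefficients of `X_{k+1}` and `X_{2n}`, which are excluded
by `3 ≤ i` and `i + t ≤ 2n - 1`. -/
theorem derivation_coord_shift (t i : ℕ) (hi : 3 ≤ i) (h : i + t ≤ 2 * n - 1) :
    coord (D (X 𝔽 n (2 + t))) (i + t) = coord (D (X 𝔽 n 2)) i := by
  induction t with
  | zero => rfl
  | succ t ih =>
    rw [← add_assoc, ← lie_X_one (by omega) (by omega), LieDerivation.apply_lie_eq_add, coord_add,
      coord_lie_mid _ _ (by omega) (by omega), coord_lie_mid _ _ (by omega) (by omega),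
      ← ih (by omega), show i + (t + 1) - 1 = i + t by omega, coord_X _ (by omega) (by omega),
      coord_X _ (by omega) (by omega), coord_X _ (by omega) (by omega), coord_X _ (by omega) (by omega),
      if_pos rfl, if_neg (by omega), if_neg (by omega), if_neg (by omega)]
    ring

/-- In the `X_{2n}`-coefficient of `D [X₂, X_{2n+1-2i}] = 0` both terms equal this coordinate, by
`derivation_coord_shift`, so its double vanishes. For an odd index the signs would make the two
terms cancel, which is why the `F₂^{2k+1}` survive. -/
theorem derivation_X_two_coord_even [CharZero 𝔽] {i : ℕ} (hi : 2 ≤ i) (hi' : i ≤ n - 1) :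
    coord (D (X 𝔽 n 2)) (2 * i) = 0 := by
  have h := lie_X_of_two_le (𝔽 := 𝔽) (n := n) (i := 2) (j := 2 * n + 1 - 2 * i) (by omega) (by omega)
    (by omega) (by omega)
  rw [if_neg (by omega)] at h
  have h' := congrArg (fun x => coord (D x) (2 * n)) h
  simp only [LieDerivation.apply_lie_eq_add, coord_add, map_zero, coord_zero] at h'
  have hodd : Odd (2 * n + 1 - 2 * i) := ⟨n - i, by omega⟩
  rw [coord_lie_top _ _ (by omega), coord_lie_top _ _ (by omega), top_X_left (by omega) (by omega),
    top_X_right (by omega) (by omega), if_pos (by omega), if_pos (by omega), hodd.neg_one_pow,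
    show 2 * n + 1 - (2 * n + 1 - 2 * i) = 2 * i by omega] at h'
  have hs := derivation_coord_shift D (2 * n + 1 - 2 * i - 2) (2 * i) (by omega) (by omega)
  rw [show 2 + (2 * n + 1 - 2 * i - 2) = 2 * n + 1 - 2 * i by omega,
    show 2 * i + (2 * n + 1 - 2 * i - 2) = 2 * n + 1 - 2 by omega] at hs
  rw [hs] at h'
  have h2 : (2 : 𝔽) * coord (D (X 𝔽 n 2)) (2 * i) = 0 := by linear_combination h'
  simpa using h2

/-- The combination `p F₁¹ + q F₂² + c F₁^{2n} + ∑ b_k F₂^{2k+1}`. -/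
def standardDerivation (n : ℕ) (p q c : 𝔽) (b : ℕ → 𝔽) :
    LieDerivation 𝔽 (QAlg 𝔽 n) (QAlg 𝔽 n) :=
  p • F11 𝔽 n + q • F22 𝔽 n + c • F12n 𝔽 n + ∑ k ∈ Finset.Icc 2 (n - 1), b k • F2odd 𝔽 n k

theorem sum_derivation_apply {ι : Type*} (s : Finset ι)
    (f : ι → LieDerivation 𝔽 (QAlg 𝔽 n) (QAlg 𝔽 n)) (x : QAlg 𝔽 n) :
    (∑ i ∈ s, f i) x = ∑ i ∈ s, f i x := by
  rw [← LieDerivation.coeFnAddMonoidHom_apply, map_sum, Finset.sum_apply]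
  rfl

theorem coord_standardDerivation (p q c : 𝔽) (b : ℕ → 𝔽) (x : QAlg 𝔽 n) {m : ℕ} (h1 : 1 ≤ m)
    (h2 : m ≤ 2 * n) : coord (standardDerivation n p q c b x) m =
      p * (if m = 2 * n then (2 * (n : 𝔽) - 3) * coord x m
        else if m = 1 then coord x m else ((m : 𝔽) - 2) * coord x m) +
      q * (if m = 2 * n then 2 * coord x m else if m = 1 then 0 else coord x m) +
      c * (if m = 2 * n then coord x 1 else 0) +
      ∑ k ∈ Finset.Icc 2 (n - 1), b k *
        (if 1 ≤ k ∧ 2 * k + 1 ≤ m ∧ m ≤ 2 * n - 1 then coord x (m + 1 - 2 * k) else 0) := by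
  simp only [standardDerivation, LieDerivation.add_apply, LieDerivation.smul_apply,
    sum_derivation_apply, coord_add, coord_smul, coord_sum, F11_apply, F22_apply, F12n_apply,
    F2odd_apply, coord_ofCoord_of_le _ h1 h2]

theorem exists_eq_standardDerivation_add_inner [CharZero 𝔽] (hn : 3 ≤ n) :
    ∃ (p q c : 𝔽) (b : ℕ → 𝔽) (z : QAlg 𝔽 n),
      D = standardDerivation n p q c b - LieDerivation.inner 𝔽 (QAlg 𝔽 n) (QAlg 𝔽 n) z := by
  -- `inner z` is `x ↦ [x, z]`, so subtracting it adds `ad z`. The coordinates of `z` are those for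
  -- which `ad z` accounts for the `X₃`- and `X_{2n}`-coefficients of `D X₂` and for those of `D X₁`
  -- from `X₃` to `X_{2n-1}`. The central coordinate `m = 2n` gets the default value `0`.
  let z : QAlg 𝔽 n := ofCoord fun m => if m = 1 then coord (D (X 𝔽 n 2)) 3 else
    if m = 2 * n - 1 then -coord (D (X 𝔽 n 2)) (2 * n) else -coord (D (X 𝔽 n 1)) (m + 1)
  have hz : ∀ m, 1 ≤ m → m ≤ 2 * n → coord z m = if m = 1 then coord (D (X 𝔽 n 2)) 3 else
    if m = 2 * n - 1 then -coord (D (X 𝔽 n 2)) (2 * n) else -coord (D (X 𝔽 n 1)) (m + 1) :=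
    fun m h1 h2 => coord_ofCoord_of_le _ h1 h2
  refine ⟨coord (D (X 𝔽 n 1)) 1, coord (D (X 𝔽 n 2)) 2, coord (D (X 𝔽 n 1)) (2 * n),
    fun k => coord (D (X 𝔽 n 2)) (2 * k + 1), z, ?_⟩
  rw [← sub_eq_zero]
  refine derivation_eq_zero hn _ ?_ ?_
  · ext m h1 h2
    simp only [LieDerivation.sub_apply, LieDerivation.inner_apply_apply, coord_sub, coord_zero,
      coord_standardDerivation _ _ _ _ _ h1 h2]
    rw [Finset.sum_eq_zero]
    swap
    · intro k hk
      rw [Finset.mem_Icc] at hk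
      split_ifs
      · rw [coord_X _ (by omega) (by omega), if_neg (by omega), mul_zero]
      · rw [mul_zero]
    rw [coord_X _ h1 h2, coord_X _ (by omega) (by omega), if_pos rfl]
    obtain rfl | hm := eq_or_ne m (2 * n)
    · rw [coord_lie_top _ _ (by omega), top_X_left (by omega) (by omega),
        if_neg (show ¬ (2 ≤ 1 ∧ 1 ≤ 2 * n - 1) by omega), if_pos rfl, if_pos rfl, if_pos rfl,
        if_neg (show ¬ 2 * n = 1 by omega)]
      ring
    rw [if_neg hm, if_neg hm, if_neg hm]
    obtain rfl | hm1 := eq_or_ne m 1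
    · rw [coord_lie_low _ _ (by omega) (by omega)]
      simp
    rw [if_neg hm1, if_neg hm1, if_neg hm1]
    obtain rfl | hm2 := eq_or_ne m 2
    · rw [coord_lie_low _ _ (by omega) (by omega), derivation_X_one_coord_two D hn]
      simp
    · rw [coord_lie_mid _ _ (by omega) (by omega), hz (m - 1) (by omega) (by omega),
        coord_X _ (by omega) (by omega), coord_X _ (by omega) (by omega), if_pos rfl,
        if_neg (show ¬ m - 1 = 1 by omega), if_neg (show ¬ m - 1 = 1 by omega),
        if_neg (show ¬ m - 1 = 2 * n - 1 by omega), show m - 1 + 1 = m by omega]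
      ring
  · ext m h1 h2
    simp only [LieDerivation.sub_apply, LieDerivation.inner_apply_apply, coord_sub, coord_zero,
      coord_standardDerivation _ _ _ _ _ h1 h2]
    -- `F₂^{2k+1}` sends `X₂` to `X_{2k+1}`, so at most one summand contributes to coordinate `m`,
    -- and none if `m` is even. The coordinate `m = 3`, outside the range of `k`, is left to `z`.
    have hs : ∀ k ∈ Finset.Icc 2 (n - 1), coord (D (X 𝔽 n 2)) (2 * k + 1) *
        (if 1 ≤ k ∧ 2 * k + 1 ≤ m ∧ m ≤ 2 * n - 1 then coord (X 𝔽 n 2) (m + 1 - 2 * k) else 0) =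
        if k = (m - 1) / 2 then (if Odd m then coord (D (X 𝔽 n 2)) m else 0) else 0 := by
      intro k hk
      rw [Finset.mem_Icc] at hk
      by_cases hkm : m = 2 * k + 1
      · rw [if_pos (by omega), coord_X _ (by omega) (by omega), if_pos (by omega), if_pos (by omega),
          if_pos ⟨k, hkm⟩, mul_one, hkm]
      · have : ¬ (k = (m - 1) / 2 ∧ Odd m) := by
          rintro ⟨h, r, hr⟩
          omega
        rw [← ite_and, if_neg this]
        split_ifs
        · rw [coord_X _ (by omega) (by omega), if_neg (by omega), mul_zero]
        · rw [mul_zero]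
    rw [Finset.sum_congr rfl hs, Finset.sum_ite_eq', coord_X _ h1 h2, coord_X _ (by omega) (by omega),
      if_neg (show ¬ 1 = 2 by omega)]
    obtain rfl | hm := eq_or_ne m (2 * n)
    · have : ¬ Odd (2 * n) := by simp
      rw [coord_lie_top _ _ (by omega), top_X_left (by omega) (by omega), 
        if_pos (show 2 ≤ 2 ∧ 2 ≤ 2 * n - 1 by omega), hz _ (by omega) (by omega),
        if_neg (show ¬ 2 * n + 1 - 2 = 1 by omega), if_pos (show 2 * n + 1 - 2 = 2 * n - 1 by omega),
        if_pos rfl, if_pos rfl, if_neg (show ¬ 2 * n = 2 by omega), if_neg this]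
      simp
    rw [if_neg hm, if_neg hm, if_neg hm]
    obtain rfl | hm1 := eq_or_ne m 1
    · rw [coord_lie_low _ _ (by omega) (by omega), derivation_X_two_coord_one D hn]
      simp
    rw [if_neg hm1, if_neg hm1]
    obtain rfl | hm2 := eq_or_ne m 2
    · rw [coord_lie_low _ _ (by omega) (by omega)]
      simp
    rw [if_neg hm2, coord_lie_mid _ _ (by omega) (by omega),
      coord_X _ (by omega) (by omega), coord_X _ (by omega) (by omega), if_neg (show ¬ 1 = 2 by omega),
      hz 1 (by omega) (by omega), if_pos rfl]
    obtain rfl | hm3 := eq_or_ne m 3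
    · simp
    rw [if_neg (show ¬ m - 1 = 2 by omega)]
    obtain ⟨r, hr⟩ | ho := Nat.even_or_odd m
    · have he : ¬ Odd m := Nat.not_odd_iff_even.2 ⟨r, hr⟩
      have := derivation_X_two_coord_even D (i := r) (by omega) (by omega)
      rw [show 2 * r = m by omega] at this
      rw [if_neg he, this]
      simp
    · obtain ⟨r, hr⟩ := ho
      rw [if_pos (Finset.mem_Icc.2 (by omega)), if_pos ⟨r, hr⟩]
      simp

end Derivations

end QAlg

/-! ### Conjugation by the exponential of a nilpotent derivation -/

/-- This is `e^P X e^{-P} = X + [P, X]`, the series for `exp (ad P)` stopping because `P` commutes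
with `B = [P, X]`. Termwise, `[P^(i+1), X] = (i+1) B P^i`, and the factor `i + 1` turns `1/(i+1)!`
into `1/i!`. -/
theorem IsNilpotent.exp_mul_eq_of_commutator {A : Type*} [Ring A] [Module ℚ A] {P X B : A}
    (hP : IsNilpotent P) (hX : P * X = X * P + B) (hB : P * B = B * P) :
    IsNilpotent.exp P * X = (X + B) * IsNilpotent.exp P := by
  have hpow : ∀ i : ℕ, P ^ (i + 1) * X = X * P ^ (i + 1) + (i + 1 : ℕ) • (B * P ^ i) := by
    intro i
    induction i with
    | zero => simpa using hX
    | succ i ih =>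
      rw [pow_succ' P (i + 1), mul_assoc, ih, mul_add, ← mul_assoc, hX, mul_smul_comm, ← mul_assoc,
        hB, add_mul, mul_assoc B, mul_assoc X, ← pow_succ' P (i + 1), ← pow_succ' P i,
        succ_nsmul _ (i + 1)]
      abel
  obtain ⟨k, hk⟩ := hP
  have hk' : P ^ (k + 1) = 0 := by rw [_root_.pow_succ, hk, zero_mul]
  rw [add_mul, IsNilpotent.exp_eq_sum hk']
  -- The exponential multiplied by `B` is truncated one term earlier than the other two, to match
  -- the shift of index in `hpow`.
  nth_rewrite 3 [← IsNilpotent.exp_eq_sum hk']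
  rw [IsNilpotent.exp_eq_sum hk, Finset.sum_range_succ', add_mul, mul_add, Finset.sum_mul,
    Finset.mul_sum, Finset.mul_sum]
  have : ∀ i ∈ Finset.range k, ((i + 1).factorial : ℚ)⁻¹ • P ^ (i + 1) * X =
      X * ((i + 1).factorial : ℚ)⁻¹ • P ^ (i + 1) + B * (i.factorial : ℚ)⁻¹ • P ^ i := by
    intro i _
    rw [smul_mul_assoc, hpow, smul_add, mul_smul_comm, mul_smul_comm, ← Nat.cast_smul_eq_nsmul ℚ,
      smul_smul, Nat.factorial_succ]
    congr 2
    push_cast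
    field_simp
  rw [Finset.sum_congr rfl this, Finset.sum_add_distrib]
  simp only [pow_zero, Nat.factorial_zero, Nat.cast_one, inv_one, one_smul, one_mul, mul_one]
  abel

theorem LieDerivation.exists_equiv_of_commutator {𝔽 K : Type*} [Field 𝔽] [CharZero 𝔽] [LieRing K]
    [LieAlgebra 𝔽 K] (P A : LieDerivation 𝔽 K K) (hP : IsNilpotent P.toLinearMap)
    (h : ⁅P, ⁅P, A⁆⁆ = 0) : ∃ φ : K ≃ₗ⁅𝔽⁆ K, ∀ x, φ (A x) = (A + ⁅P, A⁆) (φ x) := by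
  -- The exponential of a derivation is formed over `ℚ`; the rational structure is restricted from
  -- `𝔽`.
  let _ : Module ℚ K := Module.compHom K (algebraMap ℚ 𝔽)
  let _ : LieAlgebra ℚ K := { lie_smul := fun t x y => lie_smul (algebraMap ℚ 𝔽 t) x y }
  refine ⟨LieDerivation.exp P hP, fun x => ?_⟩
  have key := IsNilpotent.exp_mul_eq_of_commutator (P := P.toLinearMap) (X := A.toLinearMap)
    (B := (⁅P, A⁆ : LieDerivation 𝔽 K K).toLinearMap) hP ?_ ?_
  · rw [LieDerivation.exp_map_apply, LieDerivation.exp_map_apply]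
    exact LinearMap.congr_fun key x
  · ext x
    change P (A x) = A (P x) + ⁅P, A⁆ x
    rw [LieDerivation.commutator_apply]
    abel
  · ext x
    change P (⁅P, A⁆ x) = ⁅P, A⁆ (P x)
    have := LieDerivation.congr_fun h x
    rw [LieDerivation.commutator_apply] at this
    exact sub_eq_zero.1 this

namespace QAlg

/-! ### Nilpotency from the filtration by index -/

section Raising

variable {𝔽 : Type*} [Field 𝔽] {n : ℕ}

/-- An endomorphism that maps the span of `X_{j+1}, …, X_{2n}` into the span of
`X_{j+2}, …, X_{2n}`, for every `j`. -/
def Raises (f : Module.End 𝔽 (QAlg 𝔽 n)) : Prop :=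
  ∀ (x : QAlg 𝔽 n) (j : ℕ), (∀ m ≤ j, coord x m = 0) → ∀ m ≤ j + 1, coord (f x) m = 0

theorem coord_index_zero (x : QAlg 𝔽 n) : coord x 0 = 0 := by simp [coord]

theorem Raises.isNilpotent {f : Module.End 𝔽 (QAlg 𝔽 n)} (hf : Raises f) : IsNilpotent f := by
  refine ⟨2 * n, LinearMap.ext fun x => ext fun m _ h2 => ?_⟩
  have : ∀ i, ∀ m ≤ i, coord ((f ^ i) x) m = 0 := by
    intro i
    induction i with
    | zero =>
      intro m hm
      rw [Nat.le_zero.1 hm, coord_index_zero]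
    | succ i ih =>
      rw [pow_succ']
      exact hf _ i ih
  rw [this _ m h2, LinearMap.zero_apply, coord_zero]

/-- Without the diagonal part every term strictly raises the index: `F₁^{2n}` and `F₂^{2k+1}`
visibly, `ad z` because a bracket with `X_j` involves only basis vectors of index above `j`. -/
theorem raises_standardDerivation_sub_inner (hn : 1 ≤ n) (c : 𝔽) (b : ℕ → 𝔽) (z : QAlg 𝔽 n) :
    Raises (standardDerivation n 0 0 c b -
      LieDerivation.inner 𝔽 (QAlg 𝔽 n) (QAlg 𝔽 n) z).toLinearMap := by
  intro x j hx m hm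
  change coord ((standardDerivation n 0 0 c b - LieDerivation.inner 𝔽 (QAlg 𝔽 n) (QAlg 𝔽 n) z) x) m = 0
  by_cases hm0 : 1 ≤ m ∧ m ≤ 2 * n
  swap
  · simp [coord, hm0]
  obtain ⟨h1, h2⟩ := hm0
  rw [LieDerivation.sub_apply, coord_sub, coord_standardDerivation _ _ _ _ _ h1 h2,
    LieDerivation.inner_apply_apply, Finset.sum_eq_zero]
  swap
  · intro k hk
    rw [Finset.mem_Icc] at hk
    rw [hx _ (by omega), ite_self, mul_zero]
  obtain rfl | hm2 := eq_or_ne m (2 * n)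
  · rw [coord_lie_top _ _ hn, hx 1 (by omega)]
    have : top x z = 0 := by
      refine Finset.sum_eq_zero fun k hk => ?_
      rw [Finset.mem_Icc] at hk
      rw [hx k (by omega)]
      ring
    rw [this]
    simp
  · rw [if_neg (show ¬ m = 2 * n from hm2)]
    rcases Nat.lt_or_ge m 3 with h3 | h3
    · rw [coord_lie_low _ _ h3 hm2]
      simp [hm2]
    · rw [coord_lie_mid _ _ h3 (by omega), hx 1 (by omega), hx (m - 1) (by omega)]
      simp [hm2]

theorem isNilpotent_standardDerivation (hn : 1 ≤ n) (c : 𝔽) (b : ℕ → 𝔽) :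
    IsNilpotent (standardDerivation n 0 0 c b).toLinearMap := by
  have := (raises_standardDerivation_sub_inner hn c b 0).isNilpotent
  rwa [map_zero, sub_zero] at this

end Raising

/-! ### Commutators of the basic derivations -/

section Brackets

variable {𝔽 : Type*} [Field 𝔽] {n : ℕ}

theorem lie_F12n_F11 : ⁅F12n 𝔽 n, F11 𝔽 n⁆ = -(2 * (n : 𝔽) - 4) • F12n 𝔽 n := by
  ext x m h1 h2
  rw [LieDerivation.commutator_apply, LieDerivation.smul_apply, coord_sub, coord_smul]
  simp only [F12n_apply, F11_apply, coord_ofCoord_of_le _ h1 h2, coord_ofCoord_of_le _ le_rfl (h1.trans h2)]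
  rw [if_neg (show ¬ 1 = 2 * n by omega)]
  split_ifs
  · ring
  · ring
  · ring

theorem lie_F12n_F22 : ⁅F12n 𝔽 n, F22 𝔽 n⁆ = -(2 : 𝔽) • F12n 𝔽 n := by
  ext x m h1 h2
  rw [LieDerivation.commutator_apply, LieDerivation.smul_apply, coord_sub, coord_smul]
  simp only [F12n_apply, F22_apply, coord_ofCoord_of_le _ h1 h2, coord_ofCoord_of_le _ le_rfl (h1.trans h2)]
  rw [if_neg (show ¬ 1 = 2 * n by omega)]
  split_ifs <;> simp

theorem lie_F12n_F2odd (k : ℕ) : ⁅F12n 𝔽 n, F2odd 𝔽 n k⁆ = 0 := by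
  ext x m h1 h2
  rw [LieDerivation.commutator_apply, LieDerivation.zero_apply, coord_sub, coord_zero]
  simp only [F12n_apply, F2odd_apply, coord_ofCoord_of_le _ h1 h2,
    coord_ofCoord_of_le _ le_rfl (h1.trans h2)]
  rw [if_neg (show ¬ (1 ≤ k ∧ 2 * k + 1 ≤ 1 ∧ 1 ≤ 2 * n - 1) by omega), ite_self, zero_sub,
    neg_eq_zero]
  split_ifs
  · rw [coord_ofCoord_of_le _ (by omega) (by omega), if_neg (by omega)]
  · rfl

theorem lie_F2odd_F11 (k : ℕ) : ⁅F2odd 𝔽 n k, F11 𝔽 n⁆ = -(2 * (k : 𝔽) - 1) • F2odd 𝔽 n k := by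
  ext x m h1 h2
  rw [LieDerivation.commutator_apply, LieDerivation.smul_apply, coord_sub, coord_smul]
  simp only [F2odd_apply, F11_apply, coord_ofCoord_of_le _ h1 h2]
  by_cases h : 1 ≤ k ∧ 2 * k + 1 ≤ m ∧ m ≤ 2 * n - 1
  · rw [if_pos h, if_pos h, coord_ofCoord_of_le _ (by omega) (by omega), if_neg (by omega),
      if_neg (by omega), if_neg (by omega), if_neg (by omega), Nat.cast_sub (by omega)]
    push_cast
    ring
  · rw [if_neg h, if_neg h]
    simp

theorem lie_F2odd_F22 (k : ℕ) : ⁅F2odd 𝔽 n k, F22 𝔽 n⁆ = 0 := by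
  ext x m h1 h2
  rw [LieDerivation.commutator_apply, LieDerivation.zero_apply, coord_sub, coord_zero]
  simp only [F2odd_apply, F22_apply, coord_ofCoord_of_le _ h1 h2]
  by_cases h : 1 ≤ k ∧ 2 * k + 1 ≤ m ∧ m ≤ 2 * n - 1
  · simp only [if_pos h]
    rw [coord_ofCoord_of_le _ (by omega) (by omega), if_neg (by omega),
      if_neg (by omega), if_neg (by omega), if_neg (by omega)]
    ring
  · simp only [if_neg h]
    simp

theorem lie_F2odd_F2odd (k j : ℕ) : ⁅F2odd 𝔽 n k, F2odd 𝔽 n j⁆ = 0 := by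
  have key : ∀ (k j : ℕ) (x : QAlg 𝔽 n) (m : ℕ), 1 ≤ m → m ≤ 2 * n →
      coord (F2odd 𝔽 n k (F2odd 𝔽 n j x)) m =
        if 1 ≤ k ∧ 1 ≤ j ∧ 2 * k + 2 * j ≤ m ∧ m ≤ 2 * n - 1 then coord x (m + 2 - 2 * k - 2 * j)
        else 0 := by
    intro k j x m h1 h2
    rw [F2odd_apply, coord_ofCoord_of_le _ h1 h2]
    by_cases h : 1 ≤ k ∧ 2 * k + 1 ≤ m ∧ m ≤ 2 * n - 1
    · rw [if_pos h, F2odd_apply, coord_ofCoord_of_le _ (by omega) (by omega),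
        show m + 1 - 2 * k + 1 - 2 * j = m + 2 - 2 * k - 2 * j by omega]
      exact if_congr (by omega) rfl rfl
    · rw [if_neg h, if_neg (by omega)]
  ext x m h1 h2
  rw [LieDerivation.commutator_apply, LieDerivation.zero_apply, coord_sub, coord_zero,
    key _ _ _ _ h1 h2, key _ _ _ _ h1 h2, sub_eq_zero]
  exact if_congr (by omega) (congrArg _ (by omega)) rfl

theorem lie_standardDerivation (p q c e : 𝔽) (b d : ℕ → 𝔽) :
    ⁅standardDerivation n 0 0 e d, standardDerivation n p q c b⁆ =
      standardDerivation n 0 0 (-(e * (p * (2 * n - 4) + 2 * q)))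
        (fun k => -(d k * (p * (2 * k - 1)))) := by
  have h : ∀ k, ⁅F2odd 𝔽 n k, F12n 𝔽 n⁆ = 0 := fun k => by
    rw [← lie_skew, lie_F12n_F2odd, neg_zero]
  simp only [standardDerivation, add_lie, lie_add, smul_lie, lie_smul, sum_lie, lie_sum, lie_self,
    lie_F12n_F11, lie_F12n_F22, lie_F12n_F2odd, lie_F2odd_F11, lie_F2odd_F22, lie_F2odd_F2odd,
    h, zero_smul, smul_zero, Finset.sum_const_zero, add_zero, zero_add, smul_add, Finset.smul_sum,
    smul_smul]
  rw [add_right_comm, ← add_smul]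
  congr 1
  · congr 1
    ring
  · exact Finset.sum_congr rfl fun k _ => by congr 1; ring

theorem standardDerivation_add (p q c p' q' c' : 𝔽) (b b' : ℕ → 𝔽) :
    standardDerivation n p q c b + standardDerivation n p' q' c' b' =
      standardDerivation n (p + p') (q + q') (c + c') (fun k => b k + b' k) := by
  simp only [standardDerivation, add_smul, Finset.sum_add_distrib]
  abel

theorem smul_standardDerivation (a p q c : 𝔽) (b : ℕ → 𝔽) :
    a • standardDerivation n p q c b =
      standardDerivation n (a * p) (a * q) (a * c) (fun k => a * b k) := by
  simp only [standardDerivation, smul_add, smul_smul, Finset.smul_sum]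

theorem standardDerivation_zero : standardDerivation n (0 : 𝔽) 0 0 (fun _ => 0) = 0 := by
  simp [standardDerivation]

/-- Conjugate by the exponential of `P = e F₁^{2n} + ∑ d_k F₂^{2k+1}`. The commutator of `P` with
the given derivation again lies in the abelian span of these eigenvectors, hence commutes with `P`,
and each coefficient moves by a multiple of its weight. -/
theorem exists_equiv_standardDerivation [CharZero 𝔽] (hn : 1 ≤ n) (p q c e : 𝔽) (b d : ℕ → 𝔽) :
    ∃ φ : QAlg 𝔽 n ≃ₗ⁅𝔽⁆ QAlg 𝔽 n, ∀ x, φ (standardDerivation n p q c b x) =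
      standardDerivation n p q (c - e * (p * (2 * n - 4) + 2 * q))
        (fun k => b k - d k * (p * (2 * k - 1))) (φ x) := by
  obtain ⟨φ, hφ⟩ := LieDerivation.exists_equiv_of_commutator (standardDerivation n 0 0 e d)
    (standardDerivation n p q c b) (isNilpotent_standardDerivation hn e d) (by
      rw [lie_standardDerivation, lie_standardDerivation]
      simpa using standardDerivation_zero)
  refine ⟨φ, fun x => ?_⟩
  rw [hφ, lie_standardDerivation, standardDerivation_add]
  simp only [add_zero, sub_eq_add_neg]

end Brackets

/-! ### Diagonal automorphisms -/

section Scaling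

variable {𝔽 : Type*} [Field 𝔽] {n : ℕ}

/-- The weight of `X_m` if `X₁` and `X₂` have weights `α` and `β`. -/
def weight (n : ℕ) (α β : 𝔽) (m : ℕ) : 𝔽 :=
  if m = 2 * n then α ^ (2 * n - 3) * β ^ 2 else if m = 1 then α else α ^ (m - 2) * β

theorem weight_top (α β : 𝔽) : weight n α β (2 * n) = α ^ (2 * n - 3) * β ^ 2 := if_pos rfl

theorem weight_one (α β : 𝔽) : weight n α β 1 = α := by
  rw [weight, if_neg (by omega), if_pos rfl]

theorem weight_of_ne (α β : 𝔽) {m : ℕ} (h : m ≠ 1) (h' : m ≠ 2 * n) :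
    weight n α β m = α ^ (m - 2) * β := by
  rw [weight, if_neg h', if_neg h]

/-- The endomorphism of `Q_{2n}` with `X₁ ↦ α X₁` and `X₂ ↦ β X₂`. -/
def scaleHom (hn : 2 ≤ n) (α β : 𝔽) : QAlg 𝔽 n →ₗ⁅𝔽⁆ QAlg 𝔽 n where
  toFun x := ofCoord fun m => weight n α β m * coord x m
  map_add' x y := by
    ext m h1 h2
    simp only [coord_ofCoord_of_le _ h1 h2, coord_add, mul_add]
  map_smul' c x := by
    ext m h1 h2
    simp only [coord_ofCoord_of_le _ h1 h2, coord_smul, RingHom.id_apply]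
    ring
  map_lie' {x y} := by
    ext m h1 h2
    rw [coord_ofCoord_of_le _ h1 h2]
    obtain rfl | hm := eq_or_ne m (2 * n)
    · rw [coord_lie_top _ _ (by omega), coord_lie_top _ _ (by omega)]
      unfold top
      rw [Finset.mul_sum]
      refine Finset.sum_congr rfl fun k hk => ?_
      rw [Finset.mem_Icc] at hk
      rw [coord_ofCoord_of_le _ (by omega) (by omega), coord_ofCoord_of_le _ (by omega) (by omega)]
      rw [weight_top, weight_of_ne _ _ (by omega) (by omega), weight_of_ne _ _ (by omega) (by omega),
        show 2 * n - 3 = (k - 2) + (2 * n + 1 - k - 2) by omega, pow_add]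
      ring
    · rcases Nat.lt_or_ge m 3 with h3 | h3
      · rw [coord_lie_low _ _ h3 hm, coord_lie_low _ _ h3 hm, mul_zero]
      · rw [coord_lie_mid _ _ h3 (by omega), coord_lie_mid _ _ h3 (by omega)]
        rw [coord_ofCoord_of_le _ (by omega) (by omega), coord_ofCoord_of_le _ (by omega) (by omega),
          coord_ofCoord_of_le _ (by omega) (by omega), coord_ofCoord_of_le _ (by omega) (by omega)]
        rw [weight_of_ne _ _ (show m ≠ 1 by omega) hm, weight_one,
          weight_of_ne _ _ (show m - 1 ≠ 1 by omega) (show m - 1 ≠ 2 * n by omega),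
          show m - 2 = (m - 1 - 2) + 1 by omega, pow_succ]
        ring

theorem coord_scaleHom (hn : 2 ≤ n) (α β : 𝔽) (x : QAlg 𝔽 n) {m : ℕ} (h1 : 1 ≤ m) (h2 : m ≤ 2 * n) :
    coord (scaleHom hn α β x) m = weight n α β m * coord x m := by
  exact coord_ofCoord_of_le (fun m => weight n α β m * coord x m) h1 h2

theorem weight_ne_zero {α β : 𝔽} (hα : α ≠ 0) (hβ : β ≠ 0) (m : ℕ) : weight n α β m ≠ 0 := by
  unfold weight
  split_ifs
  · exact mul_ne_zero (pow_ne_zero _ hα) (pow_ne_zero _ hβ)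
  · exact hα
  · exact mul_ne_zero (pow_ne_zero _ hα) hβ

theorem scaleHom_injective (hn : 2 ≤ n) {α β : 𝔽} (hα : α ≠ 0) (hβ : β ≠ 0) :
    Function.Injective (scaleHom hn α β) := by
  intro x y h
  ext m h1 h2
  have := congrArg (fun z => coord z m) h
  simp only [coord_scaleHom hn _ _ _ h1 h2] at this
  exact mul_left_cancel₀ (weight_ne_zero hα hβ m) this

/-- Conjugation multiplies a matrix entry from `X_i` to `X_j` by the ratio of the weights of `X_j`
and `X_i`. For `F₂^{2k+1}` the factor `β` cancels. The coefficient of `F₁^{2n}` is written `α * c`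
so that no division by `α` is needed. -/
theorem scaleHom_standardDerivation (hn : 2 ≤ n) (α β p q c : 𝔽) (b : ℕ → 𝔽) (x : QAlg 𝔽 n) :
    scaleHom hn α β (standardDerivation n p q (α * c) b x) =
      standardDerivation n p q (α ^ (2 * n - 3) * β ^ 2 * c) (fun k => α ^ (2 * k - 1) * b k)
        (scaleHom hn α β x) := by
  ext m h1 h2
  rw [coord_scaleHom hn _ _ _ h1 h2, coord_standardDerivation _ _ _ _ _ h1 h2,
    coord_standardDerivation _ _ _ _ _ h1 h2, coord_scaleHom hn _ _ _ h1 h2,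
    coord_scaleHom hn _ _ _ le_rfl (h1.trans h2), mul_add, Finset.mul_sum]
  congr 1
  · rw [weight_one]
    obtain rfl | hm := eq_or_ne m (2 * n)
    · rw [weight_top]
      simp only [if_true]
      ring
    · simp only [if_neg hm]
      split_ifs <;> ring
  · refine Finset.sum_congr rfl fun k hk => ?_
    rw [Finset.mem_Icc] at hk
    split_ifs with h
    · rw [coord_scaleHom hn _ _ _ (by omega) (by omega)]
      rw [weight_of_ne _ _ (by omega) (by omega), weight_of_ne _ _ (by omega) (by omega),
        show m - 2 = (2 * k - 1) + (m + 1 - 2 * k - 2) by omega, pow_add]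
      ring
    · ring

end Scaling

end QAlg

/-! ### Isomorphisms between extensions by a derivation -/

namespace DerExt

variable {𝔽 K L : Type*} [Field 𝔽] [LieRing K] [LieAlgebra 𝔽 K] [LieRing L] [LieAlgebra 𝔽 L]

/-- The homomorphism from the extension of `K` by `D` to `L` that is `f` on `K` and maps the
generator of the line to `y`. -/
noncomputable def lift (D : LieDerivation 𝔽 K K) (f : K →ₗ⁅𝔽⁆ L) (y : L)
    (h : ∀ x, ⁅y, f x⁆ = f (D x)) : DerExt D →ₗ⁅𝔽⁆ L where
  toLinearMap := ((f : K →ₗ[𝔽] L).coprod (LinearMap.toSpanSingleton 𝔽 L y)) ∘ₗ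
    (toProd D : DerExt D →ₗ[𝔽] K × 𝔽)
  map_lie' {u v} := by
    have e : ∀ w : DerExt D, (((f : K →ₗ[𝔽] L).coprod (LinearMap.toSpanSingleton 𝔽 L y)) ∘ₗ
        (toProd D : DerExt D →ₗ[𝔽] K × 𝔽)) w = f (toProd D w).1 + (toProd D w).2 • y := fun w => rfl
    change (((f : K →ₗ[𝔽] L).coprod (LinearMap.toSpanSingleton 𝔽 L y)) ∘ₗ
        (toProd D : DerExt D →ₗ[𝔽] K × 𝔽)) ⁅u, v⁆ = ⁅(((f : K →ₗ[𝔽] L).coprod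
        (LinearMap.toSpanSingleton 𝔽 L y)) ∘ₗ (toProd D : DerExt D →ₗ[𝔽] K × 𝔽)) u,
        (((f : K →ₗ[𝔽] L).coprod (LinearMap.toSpanSingleton 𝔽 L y)) ∘ₗ
        (toProd D : DerExt D →ₗ[𝔽] K × 𝔽)) v⁆
    have h' : ∀ x, ⁅f x, y⁆ = -f (D x) := fun x => by rw [← lie_skew, h]
    rw [e, e, e, toProd_lie]
    simp only [map_sub, map_add, LieHom.map_lie, map_smul, add_lie, lie_add, smul_lie, lie_smul, h, h',
      lie_self, smul_zero, add_zero, zero_smul, smul_neg]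
    abel

theorem lift_apply (D : LieDerivation 𝔽 K K) (f : K →ₗ⁅𝔽⁆ L) (y : L)
    (h : ∀ x, ⁅y, f x⁆ = f (D x)) (u : DerExt D) :
    lift D f y h u = f (toProd D u).1 + (toProd D u).2 • y := rfl

instance [FiniteDimensional 𝔽 K] (D : LieDerivation 𝔽 K K) : FiniteDimensional 𝔽 (DerExt D) :=
  (toProd D).symm.finiteDimensional

theorem finrank_eq [FiniteDimensional 𝔽 K] (D : LieDerivation 𝔽 K K) :
    Module.finrank 𝔽 (DerExt D) = Module.finrank 𝔽 K + 1 := by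
  rw [(toProd D).finrank_eq, Module.finrank_prod, Module.finrank_self]

theorem nonempty_equiv_of_lift [FiniteDimensional 𝔽 K] (D : LieDerivation 𝔽 K K) (f : K →ₗ⁅𝔽⁆ L)
    (hf : Function.Injective f) {y : L} (hy : ∀ x, f x ≠ y) (h : ∀ x, ⁅y, f x⁆ = f (D x))
    (hL : Module.finrank 𝔽 L = Module.finrank 𝔽 K + 1) : Nonempty (DerExt D ≃ₗ⁅𝔽⁆ L) := by
  have hinj : Function.Injective (lift D f y h) := by
    rw [injective_iff_map_eq_zero]
    intro u hu
    rw [lift_apply] at hu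
    have hs : (toProd D u).2 = 0 := by
      by_contra hs
      -- If the `Y`-component were nonzero, `f x + s y = 0` could be solved for `y`, which would
      -- then lie in the image of `f`.
      refine hy (-(toProd D u).2⁻¹ • (toProd D u).1) ?_
      rw [map_smul, eq_neg_of_add_eq_zero_left hu, smul_neg, neg_smul, neg_neg, smul_smul,
        inv_mul_cancel₀ hs, one_smul]
    rw [hs, zero_smul, add_zero] at hu
    have h0 : (toProd D u).1 = 0 := hf (hu.trans (map_zero f).symm)
    exact (toProd D).map_eq_zero_iff.1 (Prod.ext h0 hs)
  have : FiniteDimensional 𝔽 L := FiniteDimensional.of_finrank_pos (by omega)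
  have hsurj : Function.Surjective (lift D f y h) :=
    (LinearMap.injective_iff_surjective_of_finrank_eq_finrank (f := (lift D f y h).toLinearMap)
      (by rw [finrank_eq, hL])).1 hinj
  exact ⟨LieEquiv.ofBijective _ ⟨hinj, hsurj⟩⟩

/-- The inclusion of `K` into its extension by a derivation. -/
noncomputable def inl (D : LieDerivation 𝔽 K K) : K →ₗ⁅𝔽⁆ DerExt D where
  toLinearMap := ((toProd D).symm : K × 𝔽 →ₗ[𝔽] DerExt D) ∘ₗ LinearMap.inl 𝔽 K 𝔽
  map_lie' {x x'} := by
    apply (toProd D).injective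
    rw [toProd_lie]
    simp

theorem toProd_inl (D : LieDerivation 𝔽 K K) (x : K) : toProd D (inl D x) = (x, 0) :=
  (toProd D).apply_symm_apply _

theorem inl_injective (D : LieDerivation 𝔽 K K) : Function.Injective (inl D) := fun x x' h => by
  simpa [toProd_inl] using congrArg (toProd D) h

/-- The isomorphism is `φ` on `K` and sends `Y` to `z + a Y`. This covers the three moves used
below: conjugation by an automorphism, rescaling, and adding an inner derivation. -/
theorem nonempty_equiv [FiniteDimensional 𝔽 K] (D D' : LieDerivation 𝔽 K K) (φ : K →ₗ⁅𝔽⁆ K)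
    (hφ : Function.Injective φ) {a : 𝔽} (ha : a ≠ 0) (z : K)
    (h : ∀ x, φ (D x) = a • D' (φ x) + ⁅z, φ x⁆) : Nonempty (DerExt D ≃ₗ⁅𝔽⁆ DerExt D') := by
  refine nonempty_equiv_of_lift D ((inl D').comp φ) ((inl_injective D').comp hφ)
    (y := (toProd D').symm (z, a)) (fun x hx => ha ?_) (fun x => ?_) (finrank_eq D')
  · have := congrArg (fun u => (toProd D' u).2) hx
    simpa [toProd_inl] using this.symm
  · apply (toProd D').injective
    rw [toProd_lie, LieHom.comp_apply, LieHom.comp_apply, toProd_inl, toProd_inl, h]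
    simp [add_comm]

end DerExt

/-! ### Nilpotent extensions of `Q_{2n}` -/

namespace QAlg

variable {𝔽 : Type*} [Field 𝔽] {n : ℕ}

instance : FiniteDimensional 𝔽 (QAlg 𝔽 n) :=
  inferInstanceAs (FiniteDimensional 𝔽 (Set.Icc 1 (2 * n) → 𝔽))

theorem finrank_eq : Module.finrank 𝔽 (QAlg 𝔽 n) = 2 * n := by
  change Module.finrank 𝔽 (Set.Icc 1 (2 * n) → 𝔽) = 2 * n
  simp

/-- By Engel's theorem it suffices that each `ad u` is nilpotent. On `Q_{2n}` the operator `ad (x +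
s Y) = ad x + s D` is again a derivation without diagonal part, so it raises the filtration. -/
theorem isNilpotent_derExt (hn : 1 ≤ n) (c : 𝔽) (b : ℕ → 𝔽) (z : QAlg 𝔽 n) :
    LieRing.IsNilpotent (DerExt (standardDerivation n 0 0 c b -
      LieDerivation.inner 𝔽 (QAlg 𝔽 n) (QAlg 𝔽 n) z)) := by
  set D := standardDerivation n 0 0 c b - LieDerivation.inner 𝔽 (QAlg 𝔽 n) (QAlg 𝔽 n) z with hD
  rw [LieAlgebra.isNilpotent_iff_forall (R := 𝔽)]
  intro u
  set x := (DerExt.toProd D u).1 with hx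
  set s := (DerExt.toProd D u).2 with hs
  let E : Module.End 𝔽 (QAlg 𝔽 n) := (standardDerivation n 0 0 (s * c) (fun k => s * b k) -
    LieDerivation.inner 𝔽 (QAlg 𝔽 n) (QAlg 𝔽 n) (s • z + x)).toLinearMap
  have hE : ∀ w, E w = ⁅x, w⁆ + s • D w := by
    intro w
    have h := smul_standardDerivation (n := n) s 0 0 c b
    rw [mul_zero] at h
    change (standardDerivation n 0 0 (s * c) (fun k => s * b k) -
      LieDerivation.inner 𝔽 (QAlg 𝔽 n) (QAlg 𝔽 n) (s • z + x)) w = _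
    rw [← h, hD]
    simp only [LieDerivation.sub_apply, LieDerivation.smul_apply, LieDerivation.inner_apply_apply,
      lie_add, lie_smul, smul_sub]
    rw [← lie_skew x w]
    abel
  obtain ⟨k, hk⟩ : IsNilpotent E := (raises_standardDerivation_sub_inner hn _ _ _).isNilpotent
  have hpow : ∀ (j : ℕ) (v : DerExt D), (DerExt.toProd D v).2 = 0 →
      DerExt.toProd D ((LieAlgebra.ad 𝔽 (DerExt D) u ^ j) v) = ((E ^ j) (DerExt.toProd D v).1, 0) := by
    intro j v hv
    induction j with
    | zero => exact Prod.ext rfl hv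
    | succ j ih =>
      rw [pow_succ', pow_succ', Module.End.mul_apply, LieAlgebra.ad_apply, DerExt.toProd_lie, ih,
        Module.End.mul_apply, hE, zero_smul, sub_zero]
  -- The extra application of `ad u` first brings `v` into `Q_{2n}`, where `E` takes over.
  refine ⟨k + 1, LinearMap.ext fun v => (DerExt.toProd D).map_eq_zero_iff.1 ?_⟩
  rw [pow_succ, Module.End.mul_apply, hpow, hk]
  · rfl
  · rw [LieAlgebra.ad_apply, DerExt.toProd_lie]

end QAlg

/-! ### From an ideal of codimension one to a derivation -/

/-- Any `y` outside `N` spans a complement, and a line is a subalgebra, so the extension splits; `D`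
is `ad y` on `N`, transported along `e`. -/
theorem exists_equiv_derExt {𝔽 K L : Type*} [Field 𝔽] [LieRing K] [LieAlgebra 𝔽 K]
    [FiniteDimensional 𝔽 K] [LieRing L] [LieAlgebra 𝔽 L] (N : LieIdeal 𝔽 L) (e : N ≃ₗ⁅𝔽⁆ K)
    (hL : Module.finrank 𝔽 L = Module.finrank 𝔽 K + 1) :
    N ≠ ⊤ ∧ ∃ D : LieDerivation 𝔽 K K, Nonempty (L ≃ₗ⁅𝔽⁆ DerExt D) := by
  have hN : N ≠ ⊤ := by
    rintro rfl
    have h1 := e.toLinearEquiv.finrank_eq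
    have h2 : Module.finrank 𝔽 (⊤ : LieIdeal 𝔽 L) = Module.finrank 𝔽 L :=
      finrank_top 𝔽 L
    omega
  refine ⟨hN, ?_⟩
  obtain ⟨y, hy⟩ : ∃ y, y ∉ N := by
    by_contra! h
    exact hN (eq_top_iff.2 fun x _ => h x)
  let D : LieDerivation 𝔽 K K :=
    { toFun := fun x => e ⁅y, e.symm x⁆
      map_add' := fun x x' => by simp
      map_smul' := fun c x => by simp
      leibniz' := fun x x' => by
        have h1 : ∀ w : N, ⁅x, e w⁆ = e ⁅e.symm x, w⁆ := fun w => by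
          rw [LieEquiv.map_lie, LieEquiv.apply_symm_apply]
        have h2 : ∀ w : N, ⁅x', e w⁆ = e ⁅e.symm x', w⁆ := fun w => by
          rw [LieEquiv.map_lie, LieEquiv.apply_symm_apply]
        simp only [LinearMap.coe_mk, AddHom.coe_mk]
        rw [h1, h2, ← map_sub]
        congr 1
        apply Subtype.ext
        have h3 : e.symm ⁅x, x'⁆ = ⁅e.symm x, e.symm x'⁆ := LieEquiv.map_lie _ _ _
        rw [h3]
        change ⁅y, ⁅(e.symm x : L), (e.symm x' : L)⁆⁆ =
          ⁅(e.symm x : L), ⁅y, (e.symm x' : L)⁆⁆ - ⁅(e.symm x' : L), ⁅y, (e.symm x : L)⁆⁆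
        rw [leibniz_lie y, ← lie_skew ⁅y, (e.symm x : L)⁆]
        abel }
  have hD : ∀ x, D x = e ⁅y, e.symm x⁆ := fun x => rfl
  obtain ⟨g⟩ := DerExt.nonempty_equiv_of_lift D (N.incl.comp e.symm.toLieHom)
    (Subtype.val_injective.comp e.symm.injective) (y := y)
    (fun x hx => hy (hx ▸ (e.symm x).2)) (fun x => by
      change ⁅y, (e.symm x : L)⁆ = (e.symm (D x) : L)
      rw [hD, LieEquiv.symm_apply_apply]
      rfl) hL
  exact ⟨D, ⟨g.symm⟩⟩

theorem IsNilradical.eq_top_of_isNilpotent {𝔽 L : Type*} [Field 𝔽] [LieRing L] [LieAlgebra 𝔽 L]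
    {N : LieIdeal 𝔽 L} (hN : IsNilradical N) (h : LieRing.IsNilpotent L) : N = ⊤ :=
  eq_top_iff.2 <| hN.2 <| by
    have : Function.Injective (⊤ : LieIdeal 𝔽 L).incl := Subtype.val_injective
    exact this.lieAlgebra_isNilpotent

/-! ### Roots in `ℝ` and `ℂ` -/

theorem Real.exists_pow_eq_of_odd {m : ℕ} (hm : Odd m) (a : ℝ) : ∃ r : ℝ, r ^ m = a := by
  have h0 : m ≠ 0 := hm.pos.ne'
  rcases le_total 0 a with h | h
  · exact ⟨a ^ (m : ℝ)⁻¹, Real.rpow_inv_natCast_pow h h0⟩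
  · refine ⟨-(-a) ^ (m : ℝ)⁻¹, ?_⟩
    rw [hm.neg_pow, Real.rpow_inv_natCast_pow (neg_nonneg.2 h) h0, neg_neg]

theorem RCLike.exists_pow_eq_of_odd {𝔽 : Type*} [RCLike 𝔽] {m : ℕ} (hm : Odd m) (a : 𝔽) :
    ∃ r : 𝔽, r ^ m = a := by
  rcases RCLike.I_eq_zero_or_im_I_eq_one (K := 𝔽) with h | h
  · obtain ⟨r, hr⟩ := Real.exists_pow_eq_of_odd hm (RCLike.realRingEquiv h a)
    exact ⟨(RCLike.realRingEquiv h).symm r, by rw [← map_pow, hr, RingEquiv.symm_apply_apply]⟩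
  · obtain ⟨r, hr⟩ := IsAlgClosed.exists_pow_nat_eq (RCLike.complexRingEquiv h a) hm.pos
    exact ⟨(RCLike.complexRingEquiv h).symm r, by rw [← map_pow, hr, RingEquiv.symm_apply_apply]⟩

theorem RCLike.exists_sq_eq_or_neg {𝔽 : Type*} [RCLike 𝔽] (a : 𝔽) :
    ∃ r : 𝔽, r ^ 2 = a ∨ r ^ 2 = -a := by
  rcases RCLike.I_eq_zero_or_im_I_eq_one (K := 𝔽) with h | h
  · refine ⟨(RCLike.realRingEquiv h).symm (√|RCLike.realRingEquiv h a|), ?_⟩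
    rw [← map_pow, Real.sq_sqrt (abs_nonneg _)]
    rcases abs_choice (RCLike.realRingEquiv h a) with h' | h'
    · left
      rw [h', RingEquiv.symm_apply_apply]
    · right
      rw [h', map_neg, RingEquiv.symm_apply_apply]
  · obtain ⟨r, hr⟩ := IsAlgClosed.exists_pow_nat_eq (RCLike.complexRingEquiv h a) two_pos
    exact ⟨(RCLike.complexRingEquiv h).symm r,
      Or.inl (by rw [← map_pow, hr, RingEquiv.symm_apply_apply])⟩

/-- One of `c⁻¹` and `-c⁻¹` is a square. This is the source of the three values of `ε`. -/
theorem RCLike.exists_sq_mul_eq_sign {𝔽 : Type*} [RCLike 𝔽] (c : 𝔽) :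
    ∃ β ε : 𝔽, β ≠ 0 ∧ (ε = -1 ∨ ε = 0 ∨ ε = 1) ∧ β ^ 2 * c = ε := by
  obtain rfl | hc := eq_or_ne c 0
  · exact ⟨1, 0, one_ne_zero, by simp, by simp⟩
  obtain ⟨r, hr | hr⟩ := RCLike.exists_sq_eq_or_neg c⁻¹
  · refine ⟨r, 1, ?_, by simp, by rw [hr, inv_mul_cancel₀ hc]⟩
    rintro rfl
    exact inv_ne_zero hc (by simpa using hr.symm)
  · refine ⟨r, -1, ?_, by simp, by rw [hr, neg_mul, inv_mul_cancel₀ hc]⟩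
    rintro rfl
    exact inv_ne_zero hc (by simpa using hr.symm)

/-! ### Normal forms of the extensions -/

namespace QAlg

section Field

variable {𝔽 : Type*} [Field 𝔽] {n : ℕ}

theorem standardDerivation_one_eq (lam : 𝔽) :
    standardDerivation n 1 lam 0 (fun _ => 0) = F11 𝔽 n + lam • F22 𝔽 n := by
  simp [standardDerivation]

theorem standardDerivation_eps_eq (lam ε : 𝔽) :
    standardDerivation n 1 lam ε (fun _ => 0) = F11 𝔽 n + lam • F22 𝔽 n + ε • F12n 𝔽 n := by
  simp [standardDerivation]

theorem standardDerivation_fam_eq (b : ℕ → 𝔽) :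
    standardDerivation n 0 1 0 b =
      F22 𝔽 n + ∑ k ∈ Finset.Icc 2 (n - 1), b k • F2odd 𝔽 n k := by
  simp [standardDerivation]

theorem derExt_sub_inner_equiv (D : LieDerivation 𝔽 (QAlg 𝔽 n) (QAlg 𝔽 n)) (z : QAlg 𝔽 n) :
    Nonempty (DerExt (D - LieDerivation.inner 𝔽 (QAlg 𝔽 n) (QAlg 𝔽 n) z) ≃ₗ⁅𝔽⁆ DerExt D) := by
  refine DerExt.nonempty_equiv _ _ LieHom.id Function.injective_id one_ne_zero z fun x => ?_
  rw [LieHom.id_apply, LieHom.id_apply, one_smul, LieDerivation.sub_apply,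
    LieDerivation.inner_apply_apply, ← lie_skew z x, sub_eq_add_neg]

theorem derExt_smul_equiv (D : LieDerivation 𝔽 (QAlg 𝔽 n) (QAlg 𝔽 n)) {a : 𝔽} (ha : a ≠ 0) :
    Nonempty (DerExt (a • D) ≃ₗ⁅𝔽⁆ DerExt D) := by
  refine DerExt.nonempty_equiv _ _ LieHom.id Function.injective_id ha 0 fun x => ?_
  simp

theorem derExt_conj_equiv [CharZero 𝔽] (hn : 1 ≤ n) (p q c e : 𝔽) (b d : ℕ → 𝔽) :
    Nonempty (DerExt (standardDerivation n p q c b) ≃ₗ⁅𝔽⁆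
      DerExt (standardDerivation n p q (c - e * (p * (2 * n - 4) + 2 * q))
        (fun k => b k - d k * (p * (2 * k - 1))))) := by
  obtain ⟨φ, hφ⟩ := exists_equiv_standardDerivation hn p q c e b d
  refine DerExt.nonempty_equiv _ _ φ.toLieHom φ.injective one_ne_zero 0 fun x => ?_
  simpa using hφ x

theorem derExt_scale_equiv (hn : 2 ≤ n) {α β : 𝔽} (hα : α ≠ 0) (hβ : β ≠ 0) (p q c : 𝔽) (b : ℕ → 𝔽) :
    Nonempty (DerExt (standardDerivation n p q (α * c) b) ≃ₗ⁅𝔽⁆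
      DerExt (standardDerivation n p q (α ^ (2 * n - 3) * β ^ 2 * c)
        (fun k => α ^ (2 * k - 1) * b k))) := by
  refine DerExt.nonempty_equiv _ _ _ (scaleHom_injective hn hα hβ) one_ne_zero 0 fun x => ?_
  rw [scaleHom_standardDerivation]
  simp

/-- The parameters `b` can be removed if `p ≠ 0`. -/
theorem derExt_diag_equiv [CharZero 𝔽] (hn : 1 ≤ n) (q c e : 𝔽) (b : ℕ → 𝔽) :
    Nonempty (DerExt (standardDerivation n 1 q c b) ≃ₗ⁅𝔽⁆
      DerExt (standardDerivation n 1 q (c - e * (2 * n - 4 + 2 * q)) fun _ => 0)) := by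
  -- The weight `2k - 1` of `F₂^{2k+1}` is a nonzero odd integer in characteristic zero, so every
  -- `b_k` can be divided by it and removed.
  have h := derExt_conj_equiv hn 1 q c e b fun k => b k / (2 * k - 1)
  have hb : (fun k : ℕ => b k - b k / (2 * k - 1) * (1 * (2 * k - 1))) = fun _ => 0 := by
    funext k
    have hk : (2 * (k : 𝔽) - 1) ≠ 0 := by
      intro h0
      have : ((2 * k : ℕ) : 𝔽) = ((1 : ℕ) : 𝔽) := by push_cast; linear_combination h0
      have := Nat.cast_injective this
      omega
    rw [one_mul, div_mul_cancel₀ _ hk, sub_self]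
  rwa [hb, one_mul] at h

end Field

variable {𝔽 : Type*} [RCLike 𝔽] {n : ℕ}

theorem derExt_equiv_of_ne_zero (hn : 2 ≤ n) {p : 𝔽} (hp : p ≠ 0) (q c : 𝔽) (b : ℕ → 𝔽) :
    (∃ lam : 𝔽, Nonempty (DerExt (standardDerivation n p q c b) ≃ₗ⁅𝔽⁆ SolvDiag n lam)) ∨
    (∃ ε : 𝔽, (ε = -1 ∨ ε = 0 ∨ ε = 1) ∧
      Nonempty (DerExt (standardDerivation n p q c b) ≃ₗ⁅𝔽⁆ SolvEps n ε)) := by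
  obtain ⟨f⟩ := derExt_smul_equiv (standardDerivation n 1 (p⁻¹ * q) (p⁻¹ * c) fun k => p⁻¹ * b k) hp
  have hs : p • standardDerivation n 1 (p⁻¹ * q) (p⁻¹ * c) (fun k => p⁻¹ * b k) =
      standardDerivation n p q c b := by
    simp only [smul_standardDerivation, mul_one, mul_inv_cancel_left₀ hp]
  rw [hs] at f
  generalize p⁻¹ * q = lam at f
  generalize p⁻¹ * c = c' at f
  -- This is the weight of `F₁^{2n}`: when nonzero it allows `c'` to be removed, and it vanishes
  -- exactly at `lam = 2 - n`.
  obtain h | h := ne_or_eq (2 * (n : 𝔽) - 4 + 2 * lam) 0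
  · left
    obtain ⟨g⟩ := derExt_diag_equiv (n := n) (by omega) lam c' (c' / (2 * n - 4 + 2 * lam)) fun k => p⁻¹ * b k
    rw [div_mul_cancel₀ _ h, sub_self, standardDerivation_one_eq] at g
    exact ⟨lam, ⟨f.trans g⟩⟩
  · right
    have hlam : lam = 2 - n := by linear_combination h / 2
    obtain ⟨g⟩ := derExt_diag_equiv (n := n) (by omega) lam c' 0 fun k => p⁻¹ * b k
    rw [zero_mul, sub_zero] at g
    obtain ⟨β, ε, hβ, hε, hc⟩ := RCLike.exists_sq_mul_eq_sign c'
    -- With `α = 1` only the factor `β ^ 2` acts on `c'`, making it a sign or zero.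
    obtain ⟨i⟩ := derExt_scale_equiv (n := n) hn one_ne_zero hβ 1 lam c' fun _ => 0
    have hz : (fun k : ℕ => (1 : 𝔽) ^ (2 * k - 1) * 0) = fun _ => 0 := by simp
    rw [hz, one_pow, one_mul, one_mul, hc, standardDerivation_eps_eq _ ε, hlam] at i
    rw [hlam] at f g
    exact ⟨ε, hε, ⟨(f.trans g).trans i⟩⟩

theorem derExt_equiv_of_eq_zero (hn : 1 ≤ n) {q : 𝔽} (hq : q ≠ 0) (c : 𝔽) (b : ℕ → 𝔽) :
    ∃ l : ℕ → 𝔽, Nonempty (DerExt (standardDerivation n 0 q c b) ≃ₗ⁅𝔽⁆ SolvFam n l) := by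
  obtain ⟨f⟩ := derExt_smul_equiv (standardDerivation n 0 1 (q⁻¹ * c) fun k => q⁻¹ * b k) hq
  have hs : q • standardDerivation n 0 1 (q⁻¹ * c) (fun k => q⁻¹ * b k) =
      standardDerivation n 0 q c b := by
    simp only [smul_standardDerivation, mul_one, mul_zero, mul_inv_cancel_left₀ hq]
  rw [hs] at f
  -- For `p = 0`, `q = 1` the weight of `F₁^{2n}` is `2`, hence the choice `e = c / 2`; the weights
  -- of the `F₂^{2k+1}` are `0`, so nothing is gained from `d`.
  obtain ⟨g⟩ := derExt_conj_equiv (n := n) hn 0 1 (q⁻¹ * c) (q⁻¹ * c / 2) (fun k => q⁻¹ * b k) fun _ => 0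
  have hz : (fun k : ℕ => q⁻¹ * b k - 0 * (0 * (2 * (k : 𝔽) - 1))) = fun k => q⁻¹ * b k := by simp
  rw [hz, zero_mul, zero_add, mul_one, div_mul_cancel₀ _ two_ne_zero, sub_self] at g
  -- The family is indexed by `m = 2k + 1`, from which `m / 2` recovers `k`.
  refine ⟨fun m => q⁻¹ * b (m / 2), ⟨f.trans ?_⟩⟩
  have hdiv : (fun k => q⁻¹ * b ((2 * k + 1) / 2)) = fun k => q⁻¹ * b k := by
    funext k
    rw [show (2 * k + 1) / 2 = k by omega]
  have hfam := standardDerivation_fam_eq (n := n) fun k => q⁻¹ * b ((2 * k + 1) / 2)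
  rw [hdiv] at hfam
  rw [hfam] at g
  exact g

theorem solvFam_scale_equiv (hn : 2 ≤ n) {α : 𝔽} (hα : α ≠ 0) (l : ℕ → 𝔽) :
    Nonempty (SolvFam n l ≃ₗ⁅𝔽⁆ SolvFam n fun m => α ^ (m - 2) * l m) := by
  have h := derExt_scale_equiv hn hα one_ne_zero 0 1 0 fun k => l (2 * k + 1)
  rw [mul_zero, mul_zero, standardDerivation_fam_eq, standardDerivation_fam_eq] at h
  exact h

end QAlg

/-! ### The classification -/

theorem proposition5 {𝔽 : Type*} [RCLike 𝔽] (n : ℕ) (hn : 3 ≤ n) :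
    (∀ (L : Type*) [LieRing L] [LieAlgebra 𝔽 L], LieAlgebra.IsSolvable L →
      Module.finrank 𝔽 L = 2 * n + 1 →
      ∀ N : LieIdeal 𝔽 L, IsNilradical N → Nonempty (N ≃ₗ⁅𝔽⁆ QAlg 𝔽 n) →
        (∃ lam : 𝔽, Nonempty (L ≃ₗ⁅𝔽⁆ SolvDiag n lam)) ∨
        (∃ ε : 𝔽, (ε = -1 ∨ ε = 0 ∨ ε = 1) ∧ Nonempty (L ≃ₗ⁅𝔽⁆ SolvEps n ε)) ∨
        (∃ l : ℕ → 𝔽, Nonempty (L ≃ₗ⁅𝔽⁆ SolvFam n l))) ∧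
    (∀ (l : ℕ → 𝔽) (k : ℕ), 2 ≤ k → k ≤ n - 1 → l (2 * k + 1) ≠ 0 →
      (∀ j, 2 ≤ j → j < k → l (2 * j + 1) = 0) →
      ∃ l' : ℕ → 𝔽, l' (2 * k + 1) = 1 ∧ (∀ j, 2 ≤ j → j < k → l' (2 * j + 1) = 0) ∧
        Nonempty (SolvFam n l ≃ₗ⁅𝔽⁆ SolvFam n l')) := by
  constructor
  · rintro L _ _ - hL N hN ⟨e⟩
    obtain ⟨htop, D, ⟨f⟩⟩ := exists_equiv_derExt N e (by rw [hL, QAlg.finrank_eq])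
    obtain ⟨p, q, c, b, z, rfl⟩ := QAlg.exists_eq_standardDerivation_add_inner D hn
    obtain ⟨g⟩ := QAlg.derExt_sub_inner_equiv (QAlg.standardDerivation n p q c b) z
    obtain hp | rfl := ne_or_eq p 0
    · obtain ⟨lam, ⟨h⟩⟩ | ⟨ε, hε, ⟨h⟩⟩ := QAlg.derExt_equiv_of_ne_zero (n := n) (by omega) hp q c b
      · exact Or.inl ⟨lam, ⟨(f.trans g).trans h⟩⟩
      · exact Or.inr (Or.inl ⟨ε, hε, ⟨(f.trans g).trans h⟩⟩)
    obtain hq | rfl := ne_or_eq q 0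
    · obtain ⟨l, ⟨h⟩⟩ := QAlg.derExt_equiv_of_eq_zero (n := n) (by omega) hq c b
      exact Or.inr (Or.inr ⟨l, ⟨(f.trans g).trans h⟩⟩)
    -- For `p = q = 0` the whole of `L` is nilpotent, so its nilradical would be `L`, contrary to
    -- the dimension count.
    · have := QAlg.isNilpotent_derExt (n := n) (by omega) c b z
      exact absurd (hN.eq_top_of_isNilpotent
        (Function.Injective.lieAlgebra_isNilpotent (f := f.toLieHom) f.injective)) htop
  · intro l k hk _ hl hzero
    have hodd : Odd (2 * k + 1 - 2) := ⟨k - 1, by omega⟩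
    -- Scaling multiplies the parameter of index `2k + 1` by `α^(2k-1)`; zero parameters stay zero.
    obtain ⟨α, hα⟩ := RCLike.exists_pow_eq_of_odd hodd (l (2 * k + 1))⁻¹
    have hα0 : α ≠ 0 := by
      rintro rfl
      rw [zero_pow hodd.pos.ne'] at hα
      exact inv_ne_zero hl hα.symm
    refine ⟨fun m => α ^ (m - 2) * l m, ?_, fun j hj hjk => ?_,
      QAlg.solvFam_scale_equiv (by omega) hα0 l⟩
    · change α ^ (2 * k + 1 - 2) * l (2 * k + 1) = 1
      rw [hα, inv_mul_cancel₀ hl]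
    · change α ^ (2 * j + 1 - 2) * l (2 * j + 1) = 0
      rw [hzero j hj hjk, mul_zero]
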